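/- Let $\Theta$ be a finite set. Let $k(\cdot\mid\theta)$, $\theta\in\Theta$, be probability densities on $\mathbb R$ (with respect to Lebesgue measure) such that $k(x\mid\theta)>0$ for all $x$ and $\theta$, $k$ is bounded in $(x,\theta)$, each $k(\cdot\mid\theta)$ is continuously differentiable, and $\sup_{\theta,x}|k'(x\mid\theta)|<\infty$. Assume that the mixture $\sum_\theta k(\cdot\mid\theta)g(\theta)$ identifies the probability function $g$ on $\Theta$, and that $$\int_{\mathbb R}\frac{k(x\mid\theta_1)^2}{k(x\mid\theta_2)^2}\,k(x\mid\theta_3)\,dx<\infty\qquad\text{for all }\theta_1,\theta_2,\theta_3\in\Theta.$$ Let $f_Z$ be a strictly positive, bounded, uniformly continuous probability density on $\mathbb R$, and put $\tilde k(y\mid\theta)=\int f_Z(y-x)k(x\mid\theta)\,dx$. Let $g_0=\tilde g_0$ be a probability function on $\Theta$ with $g_0(\theta)>0$ for every $\theta$, and let $(\alpha_n)_{n\ge1}$ and $(\tilde\alpha_n)_{n\ge1}$ be (possibly different) sequences in $(0,1)$ with $\sum\alpha_n=\sum\tilde\alpha_n=\infty$, $\sum\alpha_n^2<\infty$ and $\sum\tilde\alpha_n^2<\infty$.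 Let $(X_n)_{n\ge1},(Y_n)_{n\ge1},(Z_n)_{n\ge1}$ be real random variables on a probability space $(\Omega,\mathcal F,P)$ with $Y_n=X_n+Z_n$ and, for every $n\ge0$: the conditional distribution of $X_{n+1}$ given $(X_i,Y_i,Z_i)_{1\le i\le n}$ has density $\sum_\theta k(\cdot\mid\theta)\tilde g_n(\theta)$, and $Z_{n+1}$ has density $f_Z$ and is independent of $\big(X_{n+1},(X_i,Y_i,Z_i)_{1\le i\le n}\big)$, where, for $n\ge0$, $$\tilde g_{n+1}(\theta)=(1-\tilde\alpha_{n+1})\tilde g_n(\theta)+\tilde\alpha_{n+1}\frac{\tilde k(Y_{n+1}\mid\theta)\tilde g_n(\theta)}{\sum_{\theta'}\tilde k(Y_{n+1}\mid\theta')\tilde g_n(\theta')}.$$ Let also, for $n\ge0$, $$g_{n+1}(\theta)=(1-\alpha_{n+1})g_n(\theta)+\alpha_{n+1}\frac{k(X_{n+1}\mid\theta)g_n(\theta)}{\sum_{\theta'}k(X_{n+1}\mid\theta')g_n(\theta')}.$$ Then, as $n\to\infty$, $$\sup_{\theta\in\Theta}|g_n(\theta)-\tilde g_n(\theta)|\to0\qquad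 P\text{-a.s.}$$ Equivalently, $g_n$ converges a.s. to the limit of $\tilde g_n$: there is a random probability function $\tilde g$ on $\Theta$ such that $\sup_\theta|\tilde g_n(\theta)-\tilde g(\theta)|\to0$ and $\sup_\theta|g_n(\theta)-\tilde g(\theta)|\to0$, $P$-a.s. -/

import Mathlib

open MeasureTheory ProbabilityTheory Filter Topology

noncomputable section

/-- `f` is a probability density function on `ℝ` with respect to Lebesgue measure. -/
def IsDensity (f : ℝ → ℝ) : Prop :=
  (∀ x, 0 ≤ f x) ∧ Integrable f ∧ ∫ x, f x = 1

/-- The finite mixture density `x ↦ ∑ θ, k(x ∣ θ) g(θ)`; a kernel `k(x ∣ θ)` is written `k θ x`. -/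
def mixture {Θ : Type*} [Fintype Θ] (k : Θ → ℝ → ℝ) (g : Θ → ℝ) (x : ℝ) : ℝ :=
  ∑ θ, k θ x * g θ

/-- The kernel of the noisy data, the convolution of the noise density with `k(· ∣ θ)`. -/
def noisyKernel {Θ : Type*} (fZ : ℝ → ℝ) (k : Θ → ℝ → ℝ) (θ : Θ) (y : ℝ) : ℝ :=
  ∫ x, fZ (y - x) * k θ x

/-- The posterior probability function `θ ↦ κ(w ∣ θ) g(θ) / ∑ θ', κ(w ∣ θ') g(θ')`. -/
def posterior {Θ : Type*} [Fintype Θ] (κ : Θ → ℝ → ℝ) (g : Θ → ℝ) (w : ℝ) (θ : Θ) : ℝ :=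
  κ θ w * g θ / mixture κ g w

/-- Newton's recursion with kernel `κ`, learning rates `a 1, a 2, …`, initial guess `g₀` and
data `w 1, w 2, …` (the values `a 0` and `w 0` are never used). -/
def newton {Θ : Type*} [Fintype Θ] (κ : Θ → ℝ → ℝ) (a : ℕ → ℝ) (g₀ : Θ → ℝ) (w : ℕ → ℝ) :
    ℕ → Θ → ℝ
  | 0 => g₀
  | n + 1 => fun θ =>
      (1 - a (n + 1)) * newton κ a g₀ w n θ
        + a (n + 1) * posterior κ (newton κ a g₀ w n) (w (n + 1)) θ

/-- Learning rates `(a n)_{n ≥ 1}` in `(0, 1)` with divergent sum and convergent sum of squares. -/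
structure IsLearningRate (a : ℕ → ℝ) : Prop where
  mem_Ioo : ∀ n, 1 ≤ n → a n ∈ Set.Ioo (0 : ℝ) 1
  not_summable : ¬ Summable (fun n : ℕ => a (n + 1))
  summable_sq : Summable (fun n : ℕ => a (n + 1) ^ 2)

/-- The sigma-algebra generated by `X i, Y i, Z i` for `1 ≤ i ≤ n`. -/
def past {Ω : Type*} (X Y Z : ℕ → Ω → ℝ) (n : ℕ) : MeasurableSpace Ω :=
  ⨆ i ∈ Finset.Icc 1 n,
    (MeasurableSpace.comap (X i) (borel ℝ) ⊔ MeasurableSpace.comap (Y i) (borel ℝ)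
      ⊔ MeasurableSpace.comap (Z i) (borel ℝ))

/-- The quasi-Bayesian learning model for density deconvolution, for sequences indexed by `n ≥ 1`:
`Y n = X n + Z n`; the noise `Z (n + 1)` has density `fZ` and is independent of `X (n + 1)` and of
the past up to time `n`; and, conditionally on the past up to time `n`, `X (n + 1)` has as density
the mixture of `k` with respect to the current Newton estimate computed from `Y 1, …, Y n`. -/
structure IsDeconvolutionModel {Ω Θ : Type*} [MeasurableSpace Ω] [Fintype Θ] (P : Measure Ω)
    (k : Θ → ℝ → ℝ) (fZ : ℝ → ℝ) (a : ℕ → ℝ) (g₀ : Θ → ℝ) (X Y Z : ℕ → Ω → ℝ) : Prop where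
  measurable_X : ∀ n, 1 ≤ n → Measurable (X n)
  measurable_Y : ∀ n, 1 ≤ n → Measurable (Y n)
  measurable_Z : ∀ n, 1 ≤ n → Measurable (Z n)
  Y_eq : ∀ n, 1 ≤ n → ∀ ω, Y n ω = X n ω + Z n ω
  law_Z : ∀ n, 1 ≤ n → P.map (Z n) = volume.withDensity (fun z => ENNReal.ofReal (fZ z))
  indep_Z : ∀ n, Indep (MeasurableSpace.comap (Z (n + 1)) (borel ℝ))
    (past X Y Z n ⊔ MeasurableSpace.comap (X (n + 1)) (borel ℝ)) P
  condLaw_X : ∀ n, ∀ B : Set ℝ, MeasurableSet B →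
    P[(X (n + 1) ⁻¹' B).indicator (fun _ => (1 : ℝ)) | past X Y Z n]
      =ᵐ[P] fun ω => ∫ x in B, mixture k (newton (noisyKernel fZ k) a g₀ (fun i => Y i ω) n) x

end

/-! Write `h n` for the noisy estimates, `g n` for the oracle estimates, and `m_h`, `m_g` for their
mixtures under `k`. Given the past, `X (n + 1)` has density `m_h`, hence `Y (n + 1)` has the
corresponding noisy mixture as density. The noisy posterior ratio therefore has conditional mean one
and `h n` is a martingale. Up to summable errors `-log (h n θ)` is then a nonnegative
supermartingale, so `h n` converges to a limit with strictly positive weights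
(`ae_tendsto_neg_log_noisy`).

The oracle recursion updates with data drawn from `m_h` instead of `m_g`. The Lyapunov function is
the cross entropy `-∑ h n θ * log (g n θ)`. It is nonnegative and linear in the martingale `h n`, so
the move of `h n` contributes no first-order drift. The move of `g n` contributes `-α` times `∫ m_h
^ 2 / m_g - 1`, the chi-square divergence, which dominates the squared `L²` distance of `m_h` and
`m_g` divided by the bound `C` of `k`. All remaining terms are quadratic in the learning rates and
have bounded second moments: by the integrability condition for the ratios of `X`, and by Jensen's
inequality for those of `Y` (`integral_crossEntropy_step_le`).

The Robbins–Siegmund theorem (`almostSupermartingale_tendsto`) gives two facts: the cross entropy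
converges, and the `L²` distances are summable against `α`. Since `∑ α = ∞`, the distance tends to
zero along a subsequence, where compactness and identifiability force `g n` to the limit of `h n`.
This pins the limit of the cross entropy to the entropy of that limit, so along the full sequence
the relative entropy of `h n` and `g n` tends to zero, and with it their Hellinger distance
(`tendsto_of_crossEntropy_tendsto`). -/

/-- The strictly positive probability functions on `Θ`. -/
def openSimplex (Θ : Type*) [Fintype Θ] : Set (Θ → ℝ) :=
  {g | (∀ θ, 0 < g θ) ∧ ∑ θ, g θ = 1}

/-- One step of Newton's recursion. -/
noncomputable def newtonStep {Θ : Type*} [Fintype Θ] (κ : Θ → ℝ → ℝ) (a : ℝ) (g : Θ → ℝ) (w : ℝ)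
    (θ : Θ) : ℝ :=
  (1 - a) * g θ + a * posterior κ g w θ

/-! ### One step of Newton's recursion: invariance of the simplex, logarithmic bound, measurability.
-/

section Step

variable {Θ : Type*} [Fintype Θ] {κ : Θ → ℝ → ℝ} {g : Θ → ℝ} {a w : ℝ}

lemma newton_succ (κ : Θ → ℝ → ℝ) (a : ℕ → ℝ) (g₀ : Θ → ℝ) (w : ℕ → ℝ) (n : ℕ) :
    newton κ a g₀ w (n + 1) = newtonStep κ (a (n + 1)) (newton κ a g₀ w n) (w (n + 1)) := rfl

lemma openSimplex.le_one (hg : g ∈ openSimplex Θ) (θ : Θ) : g θ ≤ 1 :=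
  hg.2 ▸ Finset.single_le_sum (fun i _ => (hg.1 i).le) (Finset.mem_univ θ)

lemma openSimplex.mem_stdSimplex (hg : g ∈ openSimplex Θ) : g ∈ stdSimplex ℝ Θ :=
  ⟨fun θ => (hg.1 θ).le, hg.2⟩

lemma openSimplex.nonempty (hg : g ∈ openSimplex Θ) : Nonempty Θ := by
  by_contra h
  rw [not_nonempty_iff] at h
  simpa using hg.2

lemma mixture_pos (hκ : ∀ θ x, 0 < κ θ x) (hg : g ∈ openSimplex Θ) (x : ℝ) :
    0 < mixture κ g x :=
  have := openSimplex.nonempty hg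
  Finset.sum_pos (fun θ _ => mul_pos (hκ θ x) (hg.1 θ)) Finset.univ_nonempty

lemma posterior_eq_mul (κ : Θ → ℝ → ℝ) (g : Θ → ℝ) (w : ℝ) (θ : Θ) :
    posterior κ g w θ = g θ * (κ θ w / mixture κ g w) := by
  rw [_root_.posterior]; ring

lemma posterior_mem (hκ : ∀ θ x, 0 < κ θ x) (hg : g ∈ openSimplex Θ) (w : ℝ) :
    posterior κ g w ∈ openSimplex Θ := by
  have hm := mixture_pos hκ hg w
  refine ⟨fun θ => div_pos (mul_pos (hκ θ w) (hg.1 θ)) hm, ?_⟩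
  simp only [_root_.posterior, ← Finset.sum_div]
  exact div_self hm.ne'

lemma newtonStep_mem (hκ : ∀ θ x, 0 < κ θ x) (hg : g ∈ openSimplex Θ) (ha : a ∈ Set.Ioo (0 : ℝ) 1)
    (w : ℝ) : newtonStep κ a g w ∈ openSimplex Θ := by
  have hp := posterior_mem hκ hg w
  refine ⟨fun θ => ?_, ?_⟩
  · exact add_pos (mul_pos (by linarith [ha.2]) (hg.1 θ)) (mul_pos ha.1 (hp.1 θ))
  · simp only [newtonStep, Finset.sum_add_distrib, ← Finset.mul_sum, hp.2, hg.2]; ring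

lemma le_newtonStep (hκ : ∀ θ x, 0 < κ θ x) (hg : g ∈ openSimplex Θ) (ha : a ∈ Set.Ioo (0 : ℝ) 1)
    (w : ℝ) (θ : Θ) : (1 - a) * g θ ≤ newtonStep κ a g w θ :=
  le_add_of_nonneg_right (mul_nonneg ha.1.le ((posterior_mem hκ hg w).1 θ).le)

lemma newton_mem {α : ℕ → ℝ} (hκ : ∀ θ x, 0 < κ θ x) (hg : g ∈ openSimplex Θ)
    (hα : ∀ n, 1 ≤ n → α n ∈ Set.Ioo (0 : ℝ) 1) (w : ℕ → ℝ) (n : ℕ) :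
    newton κ α g w n ∈ openSimplex Θ := by
  induction n with
  | zero => exact hg
  | succ n ih => exact newtonStep_mem hκ ih (hα _ (by omega)) _

/-- Newton's estimates are bounded from below uniformly in the data. -/
lemma exists_le_newton {α : ℕ → ℝ} (hκ : ∀ θ x, 0 < κ θ x) (hg : g ∈ openSimplex Θ)
    (hα : ∀ n, 1 ≤ n → α n ∈ Set.Ioo (0 : ℝ) 1) (n : ℕ) (θ : Θ) :
    ∃ c > 0, ∀ w, c ≤ newton κ α g w n θ := by
  induction n with
  | zero => exact ⟨g θ, hg.1 θ, fun _ => le_rfl⟩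
  | succ n ih =>
    obtain ⟨c, hc, h⟩ := ih
    have ha := hα (n + 1) (by omega)
    have h1 : 0 < 1 - α (n + 1) := by linarith [ha.2]
    exact ⟨(1 - α (n + 1)) * c, mul_pos h1 hc, fun w =>
      (mul_le_mul_of_nonneg_left (h w) h1.le).trans
        (le_newtonStep hκ (newton_mem hκ hg hα w n) ha _ θ)⟩

/-- This is `1 - 1/x ≤ log x` at `x = 1 + a * (r - 1)`. Since `r ≥ 0`, one has `x ≥ 1 - a`, so the
remainder is quadratic with a constant free of `r`, and a second moment of an unbounded ratio
suffices. -/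
lemma sub_div_le_log_one_add_mul {a r : ℝ} (ha : a ∈ Set.Ioo (0 : ℝ) 1) (hr : 0 ≤ r) :
    a * (r - 1) - a ^ 2 / (1 - a) * (r - 1) ^ 2 ≤ Real.log (1 + a * (r - 1)) := by
  have h1 : 0 < 1 - a := by linarith [ha.2]
  have h2 : 1 - a ≤ 1 + a * (r - 1) := by nlinarith [mul_nonneg ha.1.le hr]
  have h3 : 0 < 1 + a * (r - 1) := h1.trans_le h2
  have h4 := Real.one_sub_inv_le_log_of_pos h3
  have h5 : 1 - (1 + a * (r - 1))⁻¹
      = a * (r - 1) - a ^ 2 * (r - 1) ^ 2 / (1 + a * (r - 1)) := by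
    field_simp; ring
  have h6 : a ^ 2 * (r - 1) ^ 2 / (1 + a * (r - 1)) ≤ a ^ 2 * (r - 1) ^ 2 / (1 - a) :=
    div_le_div_of_nonneg_left (by positivity) h1 h2
  have h7 : a ^ 2 / (1 - a) * (r - 1) ^ 2 = a ^ 2 * (r - 1) ^ 2 / (1 - a) := by ring
  linarith

/-- The step multiplies `g θ` by `1 + a * (r - 1)` with `r` the posterior ratio. The linear term
carries the drift; the quadratic one becomes a summable error. -/
lemma neg_log_newtonStep_le (hκ : ∀ θ x, 0 < κ θ x) (hg : g ∈ openSimplex Θ)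
    (ha : a ∈ Set.Ioo (0 : ℝ) 1) (w : ℝ) (θ : Θ) :
    -Real.log (newtonStep κ a g w θ) ≤ -Real.log (g θ) - a * (κ θ w / mixture κ g w - 1)
      + a ^ 2 / (1 - a) * (κ θ w / mixture κ g w - 1) ^ 2 := by
  have hr : 0 ≤ κ θ w / mixture κ g w := (div_pos (hκ θ w) (mixture_pos hκ hg w)).le
  have h := sub_div_le_log_one_add_mul ha hr
  have h2 : newtonStep κ a g w θ = g θ * (1 + a * (κ θ w / mixture κ g w - 1)) := by
    rw [newtonStep, posterior_eq_mul]; ring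
  have h3 : 1 + a * (κ θ w / mixture κ g w - 1) ≠ 0 := by
    have := (newtonStep_mem hκ hg ha w).1 θ
    rw [h2] at this
    exact (pos_of_mul_pos_right this (hg.1 θ).le).ne'
  rw [h2, Real.log_mul (hg.1 θ).ne' h3]
  linarith

lemma measurable_mixture (hκ : ∀ θ, Measurable (κ θ)) :
    Measurable fun p : (Θ → ℝ) × ℝ => mixture κ p.1 p.2 := by
  unfold mixture
  exact Finset.measurable_sum _ fun θ _ =>
    ((hκ θ).comp measurable_snd).mul ((measurable_pi_apply θ).comp measurable_fst)

lemma measurable_newtonStep (hκ : ∀ θ, Measurable (κ θ)) (a : ℝ) :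
    Measurable fun p : (Θ → ℝ) × ℝ => newtonStep κ a p.1 p.2 := by
  refine measurable_pi_lambda _ fun θ => ?_
  unfold newtonStep _root_.posterior
  have h1 : Measurable fun p : (Θ → ℝ) × ℝ => p.1 θ := (measurable_pi_apply θ).comp measurable_fst
  exact (h1.const_mul _).add
    (((((hκ θ).comp measurable_snd).mul h1).div (measurable_mixture hκ)).const_mul _)

lemma measurable_newton {Ω : Type*} (ℱ : ℕ → MeasurableSpace Ω) (hℱ : Monotone ℱ)
    (hκ : ∀ θ, Measurable (κ θ)) (α : ℕ → ℝ) (g : Θ → ℝ) (W : ℕ → Ω → ℝ)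
    (hW : ∀ n, 1 ≤ n → Measurable[ℱ n] (W n)) (n : ℕ) :
    Measurable[ℱ n] fun ω => newton κ α g (fun i => W i ω) n := by
  induction n with
  | zero => exact @measurable_const _ _ _ (ℱ 0) _
  | succ n ih =>
    have h1 := (ih.mono (hℱ n.le_succ) le_rfl)
    have h2 : Measurable[ℱ (n + 1)] fun ω => (newton κ α g (fun i => W i ω) n, W (n + 1) ω) :=
      h1.prodMk (hW (n + 1) (by omega))
    exact (measurable_newtonStep hκ (α (n + 1))).comp h2

end Step

/-! ### Deterministic convergence argument on the simplex. -/

section Deterministic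

variable {Θ : Type*} [Fintype Θ]

/-- Relative entropy dominates the squared Hellinger distance, by `log x ≤ x - 1` at `x = √(q θ) /
√(p θ)`. -/
lemma sum_sq_sqrt_sub_le {p q : Θ → ℝ} (hp : p ∈ openSimplex Θ) (hq : q ∈ openSimplex Θ) :
    ∑ θ, (√(p θ) - √(q θ)) ^ 2 ≤ ∑ θ, p θ * Real.log (p θ) - ∑ θ, p θ * Real.log (q θ) := by
  have key : ∀ θ, 2 * (p θ - √(p θ) * √(q θ)) ≤ p θ * Real.log (p θ) - p θ * Real.log (q θ) := by
    intro θ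
    have hp' := Real.sqrt_pos.2 (hp.1 θ)
    have hq' := Real.sqrt_pos.2 (hq.1 θ)
    have h := Real.log_le_sub_one_of_pos (div_pos hq' hp')
    rw [Real.log_div hq'.ne' hp'.ne', Real.log_sqrt (hp.1 θ).le, Real.log_sqrt (hq.1 θ).le] at h
    have h2 : p θ * (√(q θ) / √(p θ)) = √(p θ) * √(q θ) := by
      nth_rewrite 1 [← Real.mul_self_sqrt (hp.1 θ).le]
      field_simp
    nlinarith [mul_le_mul_of_nonneg_left h (hp.1 θ).le]
  calc ∑ θ, (√(p θ) - √(q θ)) ^ 2 = ∑ θ, 2 * (p θ - √(p θ) * √(q θ)) := by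
        have h1 : ∀ θ, (√(p θ) - √(q θ)) ^ 2 = p θ + q θ - 2 * (√(p θ) * √(q θ)) := by
          intro θ
          nlinarith [Real.mul_self_sqrt (hp.1 θ).le, Real.mul_self_sqrt (hq.1 θ).le]
        simp only [h1, mul_sub, Finset.sum_sub_distrib, Finset.sum_add_distrib, ← Finset.mul_sum,
          hp.2, hq.2]
        ring
    _ ≤ _ := by
        rw [← Finset.sum_sub_distrib]
        exact Finset.sum_le_sum fun θ _ => key θ

lemma tendsto_of_relEntropy_tendsto_zero {p q : ℕ → Θ → ℝ} {h : Θ → ℝ}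
    (hp : ∀ n, p n ∈ openSimplex Θ) (hq : ∀ n, q n ∈ openSimplex Θ) (hph : Tendsto p atTop (𝓝 h))
    (hpq : Tendsto (fun n => ∑ θ, p n θ * Real.log (p n θ) - ∑ θ, p n θ * Real.log (q n θ))
      atTop (𝓝 0)) : Tendsto q atTop (𝓝 h) := by
  rw [tendsto_pi_nhds] at hph ⊢
  intro θ
  have h0 : Tendsto (fun n => (√(p n θ) - √(q n θ)) ^ 2) atTop (𝓝 0) := by
    refine squeeze_zero (fun n => sq_nonneg _) (fun n => ?_) hpq
    exact (Finset.single_le_sum (f := fun θ => (√(p n θ) - √(q n θ)) ^ 2)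
      (fun i _ => sq_nonneg _) (Finset.mem_univ θ)).trans (sum_sq_sqrt_sub_le (hp n) (hq n))
  have h1 : Tendsto (fun n => √(p n θ) - √(q n θ)) atTop (𝓝 0) := by
    have := h0.sqrt
    simp only [Real.sqrt_sq_eq_abs, Real.sqrt_zero] at this
    exact (tendsto_zero_iff_abs_tendsto_zero _).2 this
  have h2 : Tendsto (fun n => √(q n θ)) atTop (𝓝 √(h θ)) := by
    simpa using (hph θ).sqrt.sub h1
  have h3 := h2.pow 2
  have h4 : 0 ≤ h θ := ge_of_tendsto' (hph θ) fun n => ((hp n).1 θ).le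
  simpa [Real.sq_sqrt h4, Real.sq_sqrt ((hq _).1 θ).le] using h3

/-- If `b n ≥ ε` eventually, then `a n ≤ ε⁻¹ * (a n * b n)` eventually and `a` would be summable. -/
lemma frequently_lt_of_summable_mul {a b : ℕ → ℝ} (ha : ∀ n, 0 < a n) (hna : ¬ Summable a)
    (hab : Summable fun n => a n * b n) {ε : ℝ} (hε : 0 < ε) : ∃ᶠ n in atTop, b n < ε := by
  intro h
  simp only [not_lt] at h
  refine hna ((hab.mul_left ε⁻¹).of_norm_bounded_eventually_nat (g := fun n => ε⁻¹ * (a n * b n)) ?_)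
  filter_upwards [h] with n hn
  rw [Real.norm_of_nonneg (ha n).le, ← div_eq_inv_mul, le_div_iff₀ hε]
  exact mul_le_mul_of_nonneg_left hn (ha n).le

/-- If `p n` converges to a strictly positive limit, the cross entropy of `q n` relative to `p n`
converges and a nondegenerate divergence of `p n` and `q n` is small infinitely often, then
`q n` has the same limit as `p n`. -/
lemma tendsto_of_crossEntropy_tendsto {p q : ℕ → Θ → ℝ} {h : Θ → ℝ} {a : ℕ → ℝ} {w : ℝ}
    {Q : (Θ → ℝ) → ℝ} (hp : ∀ n, p n ∈ openSimplex Θ) (hq : ∀ n, q n ∈ openSimplex Θ)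
    (hph : Tendsto p atTop (𝓝 h)) (hh : ∀ θ, 0 < h θ)
    (hw : Tendsto (fun n => -∑ θ, p n θ * Real.log (q n θ)) atTop (𝓝 w))
    (ha : ∀ n, 0 < a n) (hna : ¬ Summable a) (haQ : Summable fun n => a n * Q (p n - q n))
    (hQc : Continuous Q)
    (hQ : ∀ g ∈ stdSimplex ℝ Θ, ∀ g' ∈ stdSimplex ℝ Θ, Q (g - g') ≤ 0 → g = g') :
    Tendsto q atTop (𝓝 h) := by
  -- Along `φ` the values of `Q` have limit superior at most zero; compactness of the simplex then
  -- supplies a further subsequence `ψ` along which `q` converges.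
  obtain ⟨φ, hφ, hφQ⟩ := extraction_forall_of_frequently
    (P := fun k n => Q (p n - q n) < 1 / ((k : ℝ) + 1))
    fun k => frequently_lt_of_summable_mul ha hna haQ (by positivity)
  obtain ⟨h', hh', ψ, hψ, hlim⟩ := (isCompact_stdSimplex ℝ Θ).tendsto_subseq
    (x := fun n => q (φ n)) fun n => openSimplex.mem_stdSimplex (hq _)
  have hφψ : Tendsto (fun n => φ (ψ n)) atTop atTop := hφ.tendsto_atTop.comp hψ.tendsto_atTop
  have hp' : Tendsto (fun n => p (φ (ψ n))) atTop (𝓝 h) := hph.comp hφψ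
  have hq' : Tendsto (fun n => q (φ (ψ n))) atTop (𝓝 h') := hlim
  have hhs : h ∈ stdSimplex ℝ Θ := (isClosed_stdSimplex ℝ Θ).mem_of_tendsto hph
    (Eventually.of_forall fun n => openSimplex.mem_stdSimplex (hp n))
  have hQ0 : Q (h - h') ≤ 0 := by
    refine le_of_tendsto_of_tendsto' ((hQc.tendsto _).comp (hp'.sub hq'))
      (tendsto_one_div_add_atTop_nhds_zero_nat.comp hψ.tendsto_atTop) fun n => ?_
    exact (hφQ (ψ n)).le
  obtain rfl : h = h' := hQ h hhs h' hh' hQ0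
  -- The full cross entropy sequence converges, so its limit can be read off along the subsequence.
  -- Strict positivity of `h` makes the logarithm continuous there.
  have hw' : w = -∑ θ, h θ * Real.log (h θ) := by
    refine tendsto_nhds_unique (hw.comp hφψ) ?_
    refine (tendsto_finsetSum _ fun θ _ => ?_).neg
    exact ((tendsto_pi_nhds.1 hp') θ).mul (((tendsto_pi_nhds.1 hq') θ).log (hh θ).ne')
  refine tendsto_of_relEntropy_tendsto_zero hp hq hph ?_
  have h1 : Tendsto (fun n => ∑ θ, p n θ * Real.log (p n θ)) atTop
      (𝓝 (∑ θ, h θ * Real.log (h θ))) :=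
    tendsto_finsetSum _ fun θ _ =>
      ((tendsto_pi_nhds.1 hph) θ).mul (((tendsto_pi_nhds.1 hph) θ).log (hh θ).ne')
  have h2 := h1.add hw
  rw [hw', add_neg_cancel] at h2
  simpa [sub_eq_add_neg] using h2

end Deterministic

/-! ### Convergence of nonnegative almost supermartingales. -/

section AlmostSupermartingale

variable {Ω : Type*} {mΩ : MeasurableSpace Ω} {P : Measure Ω} [IsProbabilityMeasure P]
  {ℱ : Filtration ℕ mΩ}

/-- Nonnegativity turns the `L¹` norm into the mean, which is at most the initial mean, so Doob's
theorem applies to `-V`. -/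
lemma Supermartingale.exists_tendsto_of_nonneg {V : ℕ → Ω → ℝ} (hV : Supermartingale V ℱ P)
    (h0 : ∀ n ω, 0 ≤ V n ω) : ∀ᵐ ω ∂P, ∃ l, Tendsto (fun n => V n ω) atTop (𝓝 l) := by
  have hs : Submartingale (-V) ℱ P := hV.neg
  have hb : ∀ n, eLpNorm ((-V) n) 1 P ≤ (∫ ω, V 0 ω ∂P).toNNReal := by
    intro n
    rw [Pi.neg_apply, eLpNorm_neg, eLpNorm_one_eq_lintegral_enorm]
    have h1 : ∫⁻ ω, ‖V n ω‖ₑ ∂P = ENNReal.ofReal (∫ ω, V n ω ∂P) := by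
      rw [ofReal_integral_eq_lintegral_ofReal (hV.integrable n) (Eventually.of_forall (h0 n))]
      exact lintegral_congr fun ω => by rw [Real.enorm_of_nonneg (h0 n ω)]
    rw [h1]
    refine ENNReal.ofReal_le_ofReal ?_
    simpa using hV.setIntegral_le (Nat.zero_le n) MeasurableSet.univ
  filter_upwards [hs.exists_ae_tendsto_of_bdd hb] with ω ⟨l, hl⟩
  exact ⟨-l, by simpa using hl.neg⟩

/-- The Robbins–Siegmund theorem with deterministic summable errors. -/
lemma almostSupermartingale_tendsto {V D : ℕ → Ω → ℝ} {c : ℕ → ℝ}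
    (hVm : ∀ n, Measurable[ℱ n] (V n)) (hDm : ∀ n, Measurable[ℱ n] (D n))
    (hVi : ∀ n, Integrable (V n) P) (hDi : ∀ n, Integrable (D n) P)
    (hV0 : ∀ n ω, 0 ≤ V n ω) (hD0 : ∀ n ω, 0 ≤ D n ω) (hc0 : ∀ n, 0 ≤ c n) (hc : Summable c)
    (h : ∀ n A, MeasurableSet[ℱ n] A →
      ∫ ω in A, V (n + 1) ω ∂P ≤ ∫ ω in A, (V n ω - D n ω + c n) ∂P) :
    ∀ᵐ ω ∂P, (∃ l, Tendsto (fun n => V n ω) atTop (𝓝 l)) ∧ Summable fun n => D n ω := by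
  -- Used with `E = 0` and `E = D`: subtracting the two limits gives convergence of the partial sums
  -- of `D`.
  have key : ∀ E : ℕ → Ω → ℝ, (∀ n, Measurable[ℱ n] (E n)) → (∀ n, Integrable (E n) P) →
      (∀ n ω, 0 ≤ E n ω) → (∀ n ω, E n ω ≤ D n ω) → ∀ᵐ ω ∂P, ∃ l, Tendsto
        (fun n => V n ω + ∑ m ∈ Finset.range n, E m ω) atTop (𝓝 l) := by
    intro E hEm hEi hE0 hED
    -- The last bracket is the tail `∑_{m ≥ n} c m`: it loses `c n` at each step, which absorbs the
    -- error, and it stays nonnegative.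
    set S : ℕ → Ω → ℝ := fun n ω => V n ω + ∑ m ∈ Finset.range n, E m ω
      + (∑' m, c m - ∑ m ∈ Finset.range n, c m) with hS
    have hSi : ∀ n, Integrable (S n) P := fun n =>
      ((hVi n).add (integrable_finsetSum _ fun m _ => hEi m)).add (integrable_const _)
    have hSm : ∀ n, Measurable[ℱ n] (S n) := by
      intro n
      have h1 : Measurable[ℱ n] fun ω => ∑ m ∈ Finset.range n, E m ω :=
        @Finset.measurable_fun_sum _ _ _ _ _ _ (ℱ n) _ _ fun m hm =>
          (hEm m).mono (ℱ.mono (Finset.mem_range.1 hm).le) le_rfl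
      exact ((hVm n).add h1).add_const _
    have hS0 : ∀ n ω, 0 ≤ S n ω := fun n ω =>
      add_nonneg (add_nonneg (hV0 n ω) (Finset.sum_nonneg fun m _ => hE0 m ω))
        (sub_nonneg.2 (hc.sum_le_tsum _ fun m _ => hc0 m))
    have hsup : Supermartingale S ℱ P := by
      refine supermartingale_of_setIntegral_succ_le (fun n => (hSm n).stronglyMeasurable) hSi ?_
      intro n A hA
      have e1 : ∀ ω, S (n + 1) ω = V (n + 1) ω + ((S n ω - V n ω) + (E n ω - c n)) := by
        intro ω; simp only [hS, Finset.sum_range_succ]; ring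
      have e2 : ∀ ω, V n ω - D n ω + c n + ((S n ω - V n ω) + (E n ω - c n))
          = S n ω + (E n ω - D n ω) := by intro ω; ring
      have hi : Integrable (fun ω => (S n ω - V n ω) + (E n ω - c n)) (P.restrict A) :=
        (((hSi n).sub (hVi n)).add ((hEi n).sub (integrable_const _))).restrict
      simp only [e1]
      rw [integral_add (hVi _).restrict hi]
      have hi2 : Integrable (fun ω => V n ω - D n ω + c n) (P.restrict A) :=
        (((hVi n).sub (hDi n)).add (integrable_const _)).restrict
      calc _ ≤ ∫ ω in A, (V n ω - D n ω + c n) ∂P + ∫ ω in A, ((S n ω - V n ω) + (E n ω - c n)) ∂P :=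
            add_le_add_left (h n A hA) _
        _ = ∫ ω in A, (S n ω + (E n ω - D n ω)) ∂P := by
            rw [← integral_add hi2 hi]; simp only [e2]
        _ ≤ ∫ ω in A, S n ω ∂P := by
            refine integral_mono ((hSi n).add ((hEi n).sub (hDi n))).restrict (hSi n).restrict ?_
            intro ω
            have := hED n ω
            simp only; linarith
    filter_upwards [Supermartingale.exists_tendsto_of_nonneg hsup hS0] with ω ⟨l, hl⟩
    have h2 := hl.sub ((tendsto_const_nhds (x := ∑' m, c m)).sub hc.hasSum.tendsto_sum_nat)
    exact ⟨_, h2.congr fun n => by simp only [hS]; ring⟩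
  have k0 := key (fun _ _ => 0) (fun n => @measurable_const _ _ _ (ℱ n) _)
    (fun n => integrable_const _) (fun _ _ => le_rfl) hD0
  have k1 := key D hDm hDi hD0 fun _ _ => le_rfl
  filter_upwards [k0, k1] with ω ⟨l, hl⟩ ⟨l', hl'⟩
  have hl2 : Tendsto (fun n => V n ω) atTop (𝓝 l) := by simpa using hl
  refine ⟨⟨l, hl2⟩, ?_⟩
  have h3 : Tendsto (fun n => ∑ m ∈ Finset.range n, D m ω) atTop (𝓝 (l' - l)) :=
    (hl'.sub hl2).congr fun n => by ring
  exact ((hasSum_iff_tendsto_nat_of_nonneg (fun n => hD0 n ω) _).2 h3).summable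

end AlmostSupermartingale

/-! ### Measures with densities, and mixtures as densities. -/

/-- The measure on `ℝ` with density `f`. -/
noncomputable def densityMeasure (f : ℝ → ℝ) : Measure ℝ :=
  volume.withDensity fun x => ENNReal.ofReal (f x)

section Density

variable {f h : ℝ → ℝ}

lemma integral_densityMeasure (hm : Measurable f) (h0 : ∀ x, 0 ≤ f x) (h : ℝ → ℝ) :
    ∫ x, h x ∂(densityMeasure f) = ∫ x, f x * h x := by
  rw [densityMeasure, integral_withDensity_eq_integral_toReal_smul hm.ennreal_ofReal (by simp)]
  simp [ENNReal.toReal_ofReal (h0 _)]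

lemma integrable_densityMeasure_iff (hm : Measurable f) (h0 : ∀ x, 0 ≤ f x) :
    Integrable h (densityMeasure f) ↔ Integrable fun x => f x * h x := by
  rw [densityMeasure, integrable_withDensity_iff_integrable_smul' hm.ennreal_ofReal (by simp)]
  simp [ENNReal.toReal_ofReal (h0 _)]

lemma IsDensity.isProbabilityMeasure (hf : IsDensity f) :
    IsProbabilityMeasure (densityMeasure f) := by
  refine ⟨?_⟩
  rw [densityMeasure, withDensity_apply _ MeasurableSet.univ, Measure.restrict_univ,
    ← ofReal_integral_eq_lintegral_ofReal hf.2.1 (Eventually.of_forall hf.1), hf.2.2]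
  simp

variable {Θ : Type*} [Fintype Θ] {κ : Θ → ℝ → ℝ} {g : Θ → ℝ}

lemma IsDensity.mixture (hκ : ∀ θ, IsDensity (κ θ)) (hg : g ∈ stdSimplex ℝ Θ) :
    IsDensity (mixture κ g) := by
  have hi : ∀ θ ∈ Finset.univ, Integrable fun x => κ θ x * g θ :=
    fun θ _ => (hκ θ).2.1.mul_const _
  refine ⟨fun x => Finset.sum_nonneg fun θ _ => mul_nonneg ((hκ θ).1 x) (hg.1 θ),
    integrable_finsetSum _ hi, ?_⟩
  change ∫ x, ∑ θ, κ θ x * g θ = 1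
  rw [integral_finsetSum _ hi]
  simp only [integral_mul_const, (hκ _).2.2, one_mul, hg.2]

lemma Measurable.mixture (hκ : ∀ θ, Measurable (κ θ)) (g : Θ → ℝ) : Measurable (mixture κ g) :=
  (measurable_mixture hκ).comp (measurable_const.prodMk measurable_id)

/-- The posterior ratio has mean one under the mixture. -/
lemma integral_ratio_densityMeasure (hm : ∀ θ, Measurable (κ θ)) (hκ : ∀ θ, IsDensity (κ θ))
    (hpos : ∀ θ x, 0 < κ θ x) (hg : g ∈ openSimplex Θ) (θ : Θ) :
    Integrable (fun x => κ θ x / mixture κ g x) (densityMeasure (mixture κ g)) ∧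
      ∫ x, κ θ x / mixture κ g x ∂(densityMeasure (mixture κ g)) = 1 := by
  have h0 : ∀ x, 0 ≤ mixture κ g x := fun x => (mixture_pos hpos hg x).le
  have e : ∀ x, mixture κ g x * (κ θ x / mixture κ g x) = κ θ x := fun x =>
    mul_div_cancel₀ _ (mixture_pos hpos hg x).ne'
  rw [integrable_densityMeasure_iff (Measurable.mixture hm g) h0,
    integral_densityMeasure (Measurable.mixture hm g) h0]
  simp only [e]
  exact ⟨(hκ θ).2.1, (hκ θ).2.2⟩

end Density

/-! ### Convolution with the noise density. -/

section Noise

variable {fZ F : ℝ → ℝ}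

lemma integrable_shift_mul (hb : ∃ C : ℝ, ∀ z, fZ z ≤ C) (h0 : ∀ z, 0 ≤ fZ z)
    (hm : Measurable fZ) (hF : Integrable F) (y : ℝ) : Integrable fun x => fZ (y - x) * F x := by
  obtain ⟨C, hC⟩ := hb
  refine hF.bdd_mul (c := C) (hm.comp (measurable_const.sub measurable_id)).aestronglyMeasurable
    (Eventually.of_forall fun x => ?_)
  rw [Real.norm_of_nonneg (h0 _)]
  exact hC _

lemma integrable_noise (hF : Integrable F) (hZ : IsDensity fZ) :
    Integrable (fun y => ∫ x, fZ (y - x) * F x) ∧ ∫ y, ∫ x, fZ (y - x) * F x = ∫ x, F x := by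
  have h1 := hF.integrable_convolution (ContinuousLinearMap.mul ℝ ℝ) hZ.2.1
  have h2 := integral_convolution (ContinuousLinearMap.mul ℝ ℝ) hF hZ.2.1
  rw [hZ.2.2] at h2
  have e : (convolution F fZ (ContinuousLinearMap.mul ℝ ℝ) volume)
      = fun y => ∫ x, fZ (y - x) * F x := by
    ext y
    simp [convolution_def, mul_comm]
  rw [e] at h1 h2
  exact ⟨h1, by simpa using h2⟩

lemma measurable_noise (hmZ : Measurable fZ) (hm : Measurable F) :
    Measurable fun y => ∫ x, fZ (y - x) * F x := by
  have h : StronglyMeasurable (Function.uncurry fun y x => fZ (y - x) * F x) := by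
    refine Measurable.stronglyMeasurable ?_
    exact (hmZ.comp (measurable_fst.sub measurable_snd)).mul (hm.comp measurable_snd)
  exact h.integral_prod_right.measurable

lemma conv_densityMeasure (hb : ∃ C : ℝ, ∀ z, fZ z ≤ C) (hZ : IsDensity fZ) (hmZ : Measurable fZ)
    (hF : Integrable F) (hF0 : ∀ x, 0 ≤ F x) (hm : Measurable F) :
    (densityMeasure F).conv (densityMeasure fZ)
      = densityMeasure fun y => ∫ x, fZ (y - x) * F x := by
  rw [densityMeasure, densityMeasure,
    conv_withDensity_eq_lconvolution hm.ennreal_ofReal hmZ.ennreal_ofReal, densityMeasure]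
  congr 1
  ext y
  rw [lconvolution_def, ofReal_integral_eq_lintegral_ofReal (integrable_shift_mul hb hZ.1 hmZ hF y)
    (Eventually.of_forall fun x => mul_nonneg (hZ.1 _) (hF0 x))]
  refine lintegral_congr fun x => ?_
  rw [ENNReal.ofReal_mul (hZ.1 _), mul_comm, neg_add_eq_sub]

variable {Θ : Type*} {k : Θ → ℝ → ℝ}

lemma mixture_noisyKernel [Fintype Θ] (hb : ∃ C : ℝ, ∀ z, fZ z ≤ C) (h0 : ∀ z, 0 ≤ fZ z)
    (hmZ : Measurable fZ) (hk : ∀ θ, Integrable (k θ)) (g : Θ → ℝ) (y : ℝ) :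
    mixture (noisyKernel fZ k) g y = ∫ x, fZ (y - x) * mixture k g x := by
  simp only [mixture, noisyKernel, Finset.mul_sum, ← mul_assoc]
  rw [integral_finsetSum _ fun θ _ => (integrable_shift_mul hb h0 hmZ (hk θ) y).mul_const _]
  simp only [integral_mul_const]

lemma noisyKernel_pos (hb : ∃ C : ℝ, ∀ z, fZ z ≤ C) (hZ : ∀ z, 0 < fZ z)
    (hmZ : Measurable fZ) (hk : ∀ θ, Integrable (k θ)) (hpos : ∀ θ x, 0 < k θ x) (θ : Θ) (y : ℝ) :
    0 < noisyKernel fZ k θ y := by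
  have hp : ∀ x, 0 < fZ (y - x) * k θ x := fun x => mul_pos (hZ _) (hpos θ x)
  rw [noisyKernel, integral_pos_iff_support_of_nonneg (fun x => (hp x).le)
    (integrable_shift_mul hb (fun z => (hZ z).le) hmZ (hk θ) y)]
  have : (Function.support fun x => fZ (y - x) * k θ x) = Set.univ :=
    Set.eq_univ_of_forall fun x => (hp x).ne'
  simp [this]

lemma isDensity_noisyKernel (hZ : IsDensity fZ) (hk : ∀ θ, IsDensity (k θ)) (θ : Θ) :
    IsDensity (noisyKernel fZ k θ) := by
  have h := integrable_noise (hk θ).2.1 hZ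
  exact ⟨fun y => integral_nonneg fun x => mul_nonneg (hZ.1 _) ((hk θ).1 x), h.1,
    h.2.trans (hk θ).2.2⟩

end Noise

/-! ### Second moments of posterior ratios, and the `L²` distance of mixtures. -/

lemma integrable_mul_kernel {Θ : Type*} {k : Θ → ℝ → ℝ} (hm : ∀ θ, Measurable (k θ))
    (hpos : ∀ θ x, 0 < k θ x) (hk : ∀ θ, IsDensity (k θ))
    (hb : ∃ C : ℝ, ∀ θ x, k θ x ≤ C) (θ θ' : Θ) :
    Integrable fun x => k θ x * k θ' x := by
  obtain ⟨C, hC⟩ := hb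
  refine (hk θ').2.1.bdd_mul (c := C) (hm θ).aestronglyMeasurable
    (Eventually.of_forall fun x => ?_)
  rw [Real.norm_of_nonneg (hpos θ x).le]
  exact hC θ x

section Moments

variable {Θ : Type*} [Fintype Θ] {k : Θ → ℝ → ℝ} {g h : Θ → ℝ} {fZ : ℝ → ℝ}

/-- A bound for the second moments of the posterior ratios. -/
noncomputable def ratioBound (k : Θ → ℝ → ℝ) : ℝ :=
  ∑ θ₁, ∑ θ₂, ∑ θ₃, ∫ x, k θ₁ x ^ 2 / k θ₂ x ^ 2 * k θ₃ x

/-- A weighted average is at least its smallest term. The index depends on `x`, which is why the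
moment bounds sum over all denominators. -/
lemma exists_le_mixture (k : Θ → ℝ → ℝ) (hg : g ∈ openSimplex Θ) (x : ℝ) :
    ∃ j, k j x ≤ mixture k g x := by
  have := openSimplex.nonempty hg
  obtain ⟨j, -, hj⟩ := Finset.exists_min_image Finset.univ (fun j => k j x) Finset.univ_nonempty
  refine ⟨j, ?_⟩
  calc k j x = ∑ θ, k j x * g θ := by rw [← Finset.mul_sum, hg.2, mul_one]
    _ ≤ _ := Finset.sum_le_sum fun θ hθ => mul_le_mul_of_nonneg_right (hj θ hθ) (hg.1 θ).le

/-- The majorant depends on neither `g` nor `h`, so the second moments stay bounded even if oracle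
weights approach zero. -/
lemma mixture_mul_ratio_sq_le (hpos : ∀ θ x, 0 < k θ x) (hg : g ∈ openSimplex Θ)
    (hh : h ∈ openSimplex Θ) (θ : Θ) (x : ℝ) :
    mixture k h x * (k θ x / mixture k g x) ^ 2
      ≤ ∑ θ₂, ∑ θ₃, k θ x ^ 2 / k θ₂ x ^ 2 * k θ₃ x := by
  obtain ⟨j, hj⟩ := exists_le_mixture k hg x
  have hterm : ∀ θ₂ θ₃, 0 ≤ k θ x ^ 2 / k θ₂ x ^ 2 * k θ₃ x := fun θ₂ θ₃ =>
    mul_nonneg (by positivity) (hpos θ₃ x).le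
  have h1 : (k θ x / mixture k g x) ^ 2 ≤ k θ x ^ 2 / k j x ^ 2 := by
    rw [div_pow]
    exact div_le_div_of_nonneg_left (by positivity) (pow_pos (hpos j x) 2)
      (pow_le_pow_left₀ (hpos j x).le hj 2)
  have h2 : mixture k h x ≤ ∑ θ₃, k θ₃ x :=
    Finset.sum_le_sum fun θ₃ _ => mul_le_of_le_one_right (hpos _ _).le (openSimplex.le_one hh _)
  calc _ ≤ (∑ θ₃, k θ₃ x) * (k θ x ^ 2 / k j x ^ 2) :=
        mul_le_mul h2 h1 (by positivity) (Finset.sum_nonneg fun i _ => (hpos i x).le)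
    _ = ∑ θ₃, k θ x ^ 2 / k j x ^ 2 * k θ₃ x := by rw [mul_comm, Finset.mul_sum]
    _ ≤ _ := Finset.single_le_sum (f := fun j => ∑ θ₃, k θ x ^ 2 / k j x ^ 2 * k θ₃ x)
        (fun i _ => Finset.sum_nonneg fun θ₃ _ => hterm i θ₃) (Finset.mem_univ j)

lemma integral_ratio_sq_le (hm : ∀ θ, Measurable (k θ)) (hpos : ∀ θ x, 0 < k θ x)
    (hint : ∀ θ₁ θ₂ θ₃, Integrable (fun x => k θ₁ x ^ 2 / k θ₂ x ^ 2 * k θ₃ x))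
    (hg : g ∈ openSimplex Θ) (hh : h ∈ openSimplex Θ) (θ : Θ) :
    Integrable (fun x => (k θ x / mixture k g x) ^ 2) (densityMeasure (mixture k h)) ∧
      ∫ x, (k θ x / mixture k g x) ^ 2 ∂(densityMeasure (mixture k h)) ≤ ratioBound k := by
  have h0 : ∀ x, 0 ≤ mixture k h x := fun x => (mixture_pos hpos hh x).le
  have hmh := Measurable.mixture hm h
  have hmg := Measurable.mixture hm g
  rw [integrable_densityMeasure_iff hmh h0, integral_densityMeasure hmh h0]
  have hS : Integrable fun x => ∑ θ₂, ∑ θ₃, k θ x ^ 2 / k θ₂ x ^ 2 * k θ₃ x :=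
    integrable_finsetSum _ fun _ _ => integrable_finsetSum _ fun _ _ => hint _ _ _
  have hnn : ∀ x, 0 ≤ mixture k h x * (k θ x / mixture k g x) ^ 2 := fun x =>
    mul_nonneg (h0 x) (sq_nonneg _)
  have hle := mixture_mul_ratio_sq_le hpos hg hh θ
  have hI : Integrable fun x => mixture k h x * (k θ x / mixture k g x) ^ 2 := by
    refine hS.mono' ?_ (Eventually.of_forall fun x => ?_)
    · exact (hmh.mul (((hm θ).div hmg).pow_const 2)).aestronglyMeasurable
    · rw [Real.norm_of_nonneg (hnn x)]; exact hle x
  refine ⟨hI, (integral_mono hI hS hle).trans ?_⟩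
  rw [integral_finsetSum _ fun _ _ => integrable_finsetSum _ fun _ _ => hint _ _ _]
  simp only [integral_finsetSum _ fun θ₃ _ => hint θ _ θ₃]
  refine Finset.single_le_sum
    (f := fun θ => ∑ θ₂, ∑ θ₃, ∫ x, k θ x ^ 2 / k θ₂ x ^ 2 * k θ₃ x) (fun i _ => ?_)
    (Finset.mem_univ θ)
  exact Finset.sum_nonneg fun θ₂ _ => Finset.sum_nonneg fun θ₃ _ =>
    integral_nonneg fun x => mul_nonneg (by positivity) (hpos _ _).le

/-- Adding noise does not increase the second moment of the posterior ratio. -/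
lemma integral_noisy_ratio_sq_le (hm : ∀ θ, Measurable (k θ)) (hpos : ∀ θ x, 0 < k θ x)
    (hk : ∀ θ, IsDensity (k θ))
    (hint : ∀ θ₁ θ₂ θ₃, Integrable (fun x => k θ₁ x ^ 2 / k θ₂ x ^ 2 * k θ₃ x))
    (hmZ : Measurable fZ) (hb : ∃ C : ℝ, ∀ z, fZ z ≤ C) (hZ : IsDensity fZ) (hZ0 : ∀ z, 0 < fZ z)
    (hh : h ∈ openSimplex Θ) (θ : Θ) :
    Integrable (fun y => (noisyKernel fZ k θ y / mixture (noisyKernel fZ k) h y) ^ 2)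
        (densityMeasure (mixture (noisyKernel fZ k) h)) ∧
      ∫ y, (noisyKernel fZ k θ y / mixture (noisyKernel fZ k) h y) ^ 2
        ∂(densityMeasure (mixture (noisyKernel fZ k) h)) ≤ ratioBound k := by
  have hki : ∀ θ, Integrable (k θ) := fun θ => (hk θ).2.1
  have hmn : ∀ θ, Measurable (noisyKernel fZ k θ) := fun θ => measurable_noise hmZ (hm θ)
  have hnpos := noisyKernel_pos hb hZ0 hmZ hki hpos
  have hmpos := mixture_pos hnpos hh
  have hmm := Measurable.mixture hmn h
  rw [integrable_densityMeasure_iff hmm fun y => (hmpos y).le,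
    integral_densityMeasure hmm fun y => (hmpos y).le]
  have hr := integral_ratio_sq_le hm hpos hint hh hh θ
  have hfpos := mixture_pos hpos hh
  rw [integrable_densityMeasure_iff (Measurable.mixture hm h) fun x => (hfpos x).le,
    integral_densityMeasure (Measurable.mixture hm h) fun x => (hfpos x).le] at hr
  obtain ⟨hG, hGle⟩ := hr
  set G : ℝ → ℝ := fun x => mixture k h x * (k θ x / mixture k h x) ^ 2 with hGdef
  have hN := integrable_noise hG hZ
  have hle : ∀ y, mixture (noisyKernel fZ k) h y
      * (noisyKernel fZ k θ y / mixture (noisyKernel fZ k) h y) ^ 2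
      ≤ ∫ x, fZ (y - x) * G x := by
    intro y
    -- When the signal has density `mixture k h`, `t` is the conditional mean of the signal's
    -- posterior ratio `r` given the noisy value `y`. Integrating `2 * t * r - t ^ 2 ≤ r ^ 2` gives
    -- Jensen's inequality pointwise in `y`.
    set t := noisyKernel fZ k θ y / mixture (noisyKernel fZ k) h y with ht
    have hmi := (IsDensity.mixture hk (openSimplex.mem_stdSimplex hh)).2.1
    have i1 := integrable_shift_mul hb hZ.1 hmZ (hki θ) y
    have i2 := integrable_shift_mul hb hZ.1 hmZ hmi y
    have i3 := integrable_shift_mul hb hZ.1 hmZ hG y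
    have key : ∫ x, (2 * t * (fZ (y - x) * k θ x) - t ^ 2 * (fZ (y - x) * mixture k h x))
        ≤ ∫ x, fZ (y - x) * G x := by
      refine integral_mono ((i1.const_mul _).sub (i2.const_mul _)) i3 fun x => ?_
      have hf := hfpos x
      have e : fZ (y - x) * G x - (2 * t * (fZ (y - x) * k θ x)
          - t ^ 2 * (fZ (y - x) * mixture k h x))
          = fZ (y - x) * mixture k h x * (k θ x / mixture k h x - t) ^ 2 := by
        simp only [hGdef]; field_simp; ring
      have := mul_nonneg (mul_nonneg (hZ.1 (y - x)) hf.le) (sq_nonneg (k θ x / mixture k h x - t))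
      simp only; linarith
    rw [integral_sub (i1.const_mul _) (i2.const_mul _), integral_const_mul, integral_const_mul,
      ← mixture_noisyKernel hb hZ.1 hmZ hki] at key
    have e1 : ∫ x, fZ (y - x) * k θ x = t * mixture (noisyKernel fZ k) h y := by
      rw [ht, div_mul_cancel₀ _ (hmpos y).ne']; rfl
    rw [e1] at key
    linarith
  have hI : Integrable fun y => mixture (noisyKernel fZ k) h y
      * (noisyKernel fZ k θ y / mixture (noisyKernel fZ k) h y) ^ 2 := by
    refine hN.1.mono' ?_ (Eventually.of_forall fun y => ?_)
    · exact (hmm.mul (((hmn θ).div hmm).pow_const 2)).aestronglyMeasurable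
    · rw [Real.norm_of_nonneg (mul_nonneg (hmpos y).le (sq_nonneg _))]; exact hle y
  exact ⟨hI, (integral_mono hI hN.1 hle).trans (hN.2.le.trans hGle)⟩

/-- The squared `L²` norm of the signed mixture with weights `v`. -/
noncomputable def mixtureSqNorm (k : Θ → ℝ → ℝ) (v : Θ → ℝ) : ℝ :=
  ∫ x, mixture k v x ^ 2

lemma mixtureSqNorm_nonneg (k : Θ → ℝ → ℝ) (v : Θ → ℝ) : 0 ≤ mixtureSqNorm k v :=
  integral_nonneg fun _ => sq_nonneg _

lemma mixture_sq (k : Θ → ℝ → ℝ) (v : Θ → ℝ) (x : ℝ) :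
    mixture k v x ^ 2 = ∑ θ, ∑ θ', (k θ x * k θ' x) * (v θ * v θ') := by
  rw [mixture, sq, Finset.sum_mul_sum]
  exact Finset.sum_congr rfl fun _ _ => Finset.sum_congr rfl fun _ _ => by ring

lemma integrable_mixture_sq (hm : ∀ θ, Measurable (k θ)) (hpos : ∀ θ x, 0 < k θ x)
    (hk : ∀ θ, IsDensity (k θ)) (hb : ∃ C : ℝ, ∀ θ x, k θ x ≤ C) (v : Θ → ℝ) :
    Integrable fun x => mixture k v x ^ 2 := by
  simp only [mixture_sq]
  exact integrable_finsetSum _ fun θ _ => integrable_finsetSum _ fun θ' _ =>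
    (integrable_mul_kernel hm hpos hk hb θ θ').mul_const _

/-- A quadratic form in the weights, with coefficients `∫ x, k θ x * k θ' x` that are finite because
`k` is bounded. -/
lemma continuous_mixtureSqNorm (hm : ∀ θ, Measurable (k θ)) (hpos : ∀ θ x, 0 < k θ x)
    (hk : ∀ θ, IsDensity (k θ)) (hb : ∃ C : ℝ, ∀ θ x, k θ x ≤ C) :
    Continuous (mixtureSqNorm k) := by
  have e : mixtureSqNorm k
      = fun v => ∑ θ, ∑ θ', (∫ x, k θ x * k θ' x) * (v θ * v θ') := by
    ext v
    have hi : ∀ θ θ', Integrable fun x => (k θ x * k θ' x) * (v θ * v θ') := fun θ θ' =>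
      (integrable_mul_kernel hm hpos hk hb θ θ').mul_const _
    rw [mixtureSqNorm]
    simp only [mixture_sq]
    rw [integral_finsetSum _ fun θ _ => integrable_finsetSum _ fun θ' _ => hi θ θ']
    refine Finset.sum_congr rfl fun θ _ => ?_
    rw [integral_finsetSum _ fun θ' _ => hi θ θ']
    exact Finset.sum_congr rfl fun θ' _ => integral_mul_const _ _
  rw [e]
  fun_prop

lemma mixture_sub (k : Θ → ℝ → ℝ) (g h : Θ → ℝ) (x : ℝ) :
    mixture k (g - h) x = mixture k g x - mixture k h x := by
  simp only [mixture, Pi.sub_apply, mul_sub, Finset.sum_sub_distrib]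

/-- A vanishing `L²` distance only gives equality almost everywhere; continuity of the kernel
upgrades it to the pointwise equality that identifiability asks for. -/
lemma mixture_eq_of_mixtureSqNorm_sub_nonpos (hc : ∀ θ, Continuous (k θ))
    (hpos : ∀ θ x, 0 < k θ x) (hk : ∀ θ, IsDensity (k θ)) (hb : ∃ C : ℝ, ∀ θ x, k θ x ≤ C)
    (h0 : mixtureSqNorm k (g - h) ≤ 0) : mixture k g = mixture k h := by
  have h1 : mixtureSqNorm k (g - h) = 0 := le_antisymm h0 (mixtureSqNorm_nonneg k _)
  rw [mixtureSqNorm, integral_eq_zero_iff_of_nonneg (fun x => sq_nonneg _)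
    (integrable_mixture_sq (fun θ => (hc θ).measurable) hpos hk hb _)] at h1
  have hcont : Continuous fun x => mixture k (g - h) x ^ 2 := by
    unfold mixture; fun_prop
  have h2 := (Continuous.ae_eq_iff_eq volume hcont continuous_zero).1 h1
  ext x
  have h3 : mixture k (g - h) x ^ 2 = 0 := congrFun h2 x
  rw [mixture_sub] at h3
  exact sub_eq_zero.1 (pow_eq_zero_iff two_ne_zero |>.1 h3)

/-- The drift of the cross entropy dominates the `L²` distance of the two mixtures. -/
lemma mixtureSqNorm_le_integral_ratio (hm : ∀ θ, Measurable (k θ)) (hpos : ∀ θ x, 0 < k θ x)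
    (hk : ∀ θ, IsDensity (k θ)) {C : ℝ} (hC : ∀ θ x, k θ x ≤ C) (hg : g ∈ openSimplex Θ)
    (hh : h ∈ openSimplex Θ)
    (hri : ∀ θ, Integrable (fun x => k θ x / mixture k g x) (densityMeasure (mixture k h))) :
    mixtureSqNorm k (h - g) / C ≤
      ∑ θ, h θ * (∫ x, k θ x / mixture k g x ∂(densityMeasure (mixture k h)) - 1) := by
  have hgpos := mixture_pos hpos hg
  have hhpos := mixture_pos hpos hh
  have hmh := Measurable.mixture hm h
  have hgC : ∀ x, mixture k g x ≤ C := fun x => by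
    calc mixture k g x ≤ ∑ θ, C * g θ :=
          Finset.sum_le_sum fun θ _ => mul_le_mul_of_nonneg_right (hC θ x) (hg.1 θ).le
      _ = C := by rw [← Finset.mul_sum, hg.2, mul_one]
  -- Averaging the ratios with the weights `h` rebuilds the mixture in the numerator, leaving the
  -- chi-square divergence.
  have e : ∑ θ, h θ * (∫ x, k θ x / mixture k g x ∂(densityMeasure (mixture k h)) - 1)
      = (∫ x, mixture k h x * (mixture k h x / mixture k g x)) - 1 := by
    rw [← integral_densityMeasure hmh (fun x => (hhpos x).le) fun x =>
      mixture k h x / mixture k g x]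
    have e2 : ∀ x, mixture k h x / mixture k g x = ∑ θ, h θ * (k θ x / mixture k g x) := by
      intro x
      conv_lhs => rw [mixture, Finset.sum_div]
      exact Finset.sum_congr rfl fun θ _ => by ring
    simp only [e2]
    rw [integral_finsetSum _ fun θ _ => (hri θ).const_mul _]
    simp only [integral_const_mul, mul_sub, Finset.sum_sub_distrib, mul_one, hh.2]
  have hI : Integrable fun x => mixture k h x * (mixture k h x / mixture k g x) := by
    rw [← integrable_densityMeasure_iff hmh fun x => (hhpos x).le]
    have := integrable_finsetSum Finset.univ fun θ _ => (hri θ).const_mul (h θ)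
    refine this.congr (Eventually.of_forall fun x => ?_)
    simp only
    conv_rhs => rw [mixture, Finset.sum_div]
    exact Finset.sum_congr rfl fun θ _ => by ring
  have dg := IsDensity.mixture hk (openSimplex.mem_stdSimplex hg)
  have dh := IsDensity.mixture hk (openSimplex.mem_stdSimplex hh)
  have hsq := integrable_mixture_sq hm hpos hk ⟨C, hC⟩ (h - g)
  -- Completing the square, `m_h ^ 2 / m_g = 2 * m_h - m_g + (m_h - m_g) ^ 2 / m_g`, and `m_g ≤ C`.
  -- The first two terms integrate to one.
  have key : ∫ x, (2 * mixture k h x - mixture k g x + mixture k (h - g) x ^ 2 / C)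
      ≤ ∫ x, mixture k h x * (mixture k h x / mixture k g x) := by
    refine integral_mono (((dh.2.1.const_mul 2).sub dg.2.1).add (hsq.div_const C)) hI fun x => ?_
    have hx := hgpos x
    have h1 : mixture k (h - g) x ^ 2 / C ≤ mixture k (h - g) x ^ 2 / mixture k g x :=
      div_le_div_of_nonneg_left (sq_nonneg _) hx (hgC x)
    have h2 : mixture k h x * (mixture k h x / mixture k g x)
        = 2 * mixture k h x - mixture k g x + mixture k (h - g) x ^ 2 / mixture k g x := by
      rw [mixture_sub]; field_simp; ring
    simp only; linarith
  have hi : Integrable fun x => 2 * mixture k h x - mixture k g x :=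
    (dh.2.1.const_mul 2).sub dg.2.1
  rw [integral_add hi (hsq.div_const C),
    integral_sub (dh.2.1.const_mul 2) dg.2.1, integral_const_mul, dh.2.2, dg.2.2,
    integral_div] at key
  rw [e]
  change (∫ x, mixture k (h - g) x ^ 2) / C ≤ _
  linarith

end Moments

/-! ### One-step drift bounds under the law of the next signal and noise. -/

lemma MeasureTheory.MeasurePreserving.integral_comp_of_integrable {α β : Type*}
    {mα : MeasurableSpace α} {mβ : MeasurableSpace β} {μ : Measure α} {ν : Measure β} {φ : α → β}
    (hφ : MeasurePreserving φ μ ν) {f : β → ℝ} (hf : Integrable f ν) :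
    Integrable (fun x => f (φ x)) μ ∧ ∫ x, f (φ x) ∂μ = ∫ y, f y ∂ν := by
  refine ⟨hφ.integrable_comp_of_integrable hf, ?_⟩
  have h := hf.aestronglyMeasurable
  rw [← hφ.map_eq] at h
  rw [← integral_map hφ.measurable.aemeasurable h, hφ.map_eq]

lemma integral_sub_one_sq_le {α : Type*} {mα : MeasurableSpace α} {μ : Measure α}
    [IsProbabilityMeasure μ] {r : α → ℝ} {M : ℝ} (hr : Integrable r μ)
    (hr2 : Integrable (fun x => r x ^ 2) μ) (h0 : ∀ x, 0 ≤ r x) (hM : ∫ x, r x ^ 2 ∂μ ≤ M) :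
    Integrable (fun x => (r x - 1) ^ 2) μ ∧ ∫ x, (r x - 1) ^ 2 ∂μ ≤ M + 1 := by
  have e : ∀ x, (r x - 1) ^ 2 = r x ^ 2 - 2 * r x + 1 := fun x => by ring
  have hI : Integrable (fun x => (r x - 1) ^ 2) μ := by
    simp only [e]
    exact (hr2.sub (hr.const_mul 2)).add (integrable_const 1)
  refine ⟨hI, ?_⟩
  calc ∫ x, (r x - 1) ^ 2 ∂μ ≤ ∫ x, (r x ^ 2 + 1) ∂μ :=
        integral_mono hI (hr2.add (integrable_const 1)) fun x => by
          have := h0 x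
          simp only [e]; linarith
    _ = ∫ x, r x ^ 2 ∂μ + 1 := by rw [integral_add hr2 (integrable_const 1)]; simp
    _ ≤ M + 1 := by linarith

/-- The standing assumptions on the kernel and the noise density; `C` bounds the kernel. -/
structure DeconvolutionAssumptions {Θ : Type*} (k : Θ → ℝ → ℝ) (fZ : ℝ → ℝ) (C : ℝ) : Prop where
  continuous_k : ∀ θ, Continuous (k θ)
  pos_k : ∀ θ x, 0 < k θ x
  isDensity_k : ∀ θ, IsDensity (k θ)
  le_k : ∀ θ x, k θ x ≤ C
  integrable_ratio : ∀ θ₁ θ₂ θ₃, Integrable (fun x => k θ₁ x ^ 2 / k θ₂ x ^ 2 * k θ₃ x)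
  measurable_fZ : Measurable fZ
  isDensity_fZ : IsDensity fZ
  pos_fZ : ∀ z, 0 < fZ z
  bdd_fZ : ∃ B : ℝ, ∀ z, fZ z ≤ B

/-- The law of the next signal and the next noise if the current noisy estimate is `h`. -/
noncomputable def stepMeasure {Θ : Type*} [Fintype Θ] (k : Θ → ℝ → ℝ) (fZ : ℝ → ℝ) (h : Θ → ℝ) :
    Measure (ℝ × ℝ) :=
  (densityMeasure (mixture k h)).prod (densityMeasure fZ)

namespace DeconvolutionAssumptions

variable {Θ : Type*} {k : Θ → ℝ → ℝ} {fZ : ℝ → ℝ} {C : ℝ}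

lemma measurable_k (H : DeconvolutionAssumptions k fZ C) (θ : Θ) : Measurable (k θ) :=
  (H.continuous_k θ).measurable

lemma pos_noisy (H : DeconvolutionAssumptions k fZ C) : ∀ θ x, 0 < noisyKernel fZ k θ x :=
  noisyKernel_pos H.bdd_fZ H.pos_fZ H.measurable_fZ (fun θ => (H.isDensity_k θ).2.1) H.pos_k

lemma measurable_noisy (H : DeconvolutionAssumptions k fZ C) (θ : Θ) :
    Measurable (noisyKernel fZ k θ) :=
  measurable_noise H.measurable_fZ (H.measurable_k θ)

variable [Fintype Θ] {g h : Θ → ℝ} {a b : ℝ}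

lemma isProbabilityMeasure_mixture (H : DeconvolutionAssumptions k fZ C) (hh : h ∈ openSimplex Θ) :
    IsProbabilityMeasure (densityMeasure (mixture k h)) :=
  (IsDensity.mixture H.isDensity_k (openSimplex.mem_stdSimplex hh)).isProbabilityMeasure

lemma isProbabilityMeasure_step (H : DeconvolutionAssumptions k fZ C) (hh : h ∈ openSimplex Θ) :
    IsProbabilityMeasure (stepMeasure k fZ h) := by
  have := H.isProbabilityMeasure_mixture hh
  have := H.isDensity_fZ.isProbabilityMeasure
  unfold stepMeasure
  infer_instance

lemma measurePreserving_fst (H : DeconvolutionAssumptions k fZ C) :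
    MeasurePreserving Prod.fst (stepMeasure k fZ h) (densityMeasure (mixture k h)) := by
  have := H.isDensity_fZ.isProbabilityMeasure
  exact MeasureTheory.measurePreserving_fst

lemma measurePreserving_add (H : DeconvolutionAssumptions k fZ C) (hh : h ∈ openSimplex Θ) :
    MeasurePreserving (fun p : ℝ × ℝ => p.1 + p.2) (stepMeasure k fZ h)
      (densityMeasure (mixture (noisyKernel fZ k) h)) := by
  have hd := IsDensity.mixture H.isDensity_k (openSimplex.mem_stdSimplex hh)
  refine ⟨by fun_prop, ?_⟩
  have e : mixture (noisyKernel fZ k) h = fun y => ∫ x, fZ (y - x) * mixture k h x :=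
    funext fun y => mixture_noisyKernel H.bdd_fZ H.isDensity_fZ.1 H.measurable_fZ
      (fun θ => (H.isDensity_k θ).2.1) h y
  rw [e, ← conv_densityMeasure H.bdd_fZ H.isDensity_fZ H.measurable_fZ hd.2.1 hd.1
    (Measurable.mixture H.measurable_k h)]
  rfl

lemma integral_noisy_ratio (H : DeconvolutionAssumptions k fZ C) (hh : h ∈ openSimplex Θ) (θ : Θ) :
    Integrable (fun p : ℝ × ℝ => noisyKernel fZ k θ (p.1 + p.2)
        / mixture (noisyKernel fZ k) h (p.1 + p.2)) (stepMeasure k fZ h) ∧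
      ∫ p, noisyKernel fZ k θ (p.1 + p.2) / mixture (noisyKernel fZ k) h (p.1 + p.2)
        ∂(stepMeasure k fZ h) = 1 := by
  have h1 := integral_ratio_densityMeasure H.measurable_noisy
    (isDensity_noisyKernel H.isDensity_fZ H.isDensity_k) H.pos_noisy hh θ
  have h2 := (H.measurePreserving_add hh).integral_comp_of_integrable h1.1
  exact ⟨h2.1, h2.2.trans h1.2⟩

lemma integral_noisy_ratio_sub_one_sq (H : DeconvolutionAssumptions k fZ C)
    (hh : h ∈ openSimplex Θ) (θ : Θ) :
    Integrable (fun p : ℝ × ℝ => (noisyKernel fZ k θ (p.1 + p.2)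
        / mixture (noisyKernel fZ k) h (p.1 + p.2) - 1) ^ 2) (stepMeasure k fZ h) ∧
      ∫ p, (noisyKernel fZ k θ (p.1 + p.2) / mixture (noisyKernel fZ k) h (p.1 + p.2) - 1) ^ 2
        ∂(stepMeasure k fZ h) ≤ ratioBound k + 1 := by
  have := H.isProbabilityMeasure_step hh
  have h1 := integral_noisy_ratio_sq_le H.measurable_k H.pos_k H.isDensity_k H.integrable_ratio
    H.measurable_fZ H.bdd_fZ H.isDensity_fZ H.pos_fZ hh θ
  have h2 := (H.measurePreserving_add hh).integral_comp_of_integrable h1.1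
  exact integral_sub_one_sq_le (H.integral_noisy_ratio hh θ).1 h2.1
    (fun p => (div_pos (H.pos_noisy θ _) (mixture_pos H.pos_noisy hh _)).le) (h2.2.trans_le h1.2)

lemma integrable_ratio_mixture (H : DeconvolutionAssumptions k fZ C) (hg : g ∈ openSimplex Θ)
    (hh : h ∈ openSimplex Θ) (θ : Θ) :
    Integrable (fun x => k θ x / mixture k g x) (densityMeasure (mixture k h)) := by
  have := H.isProbabilityMeasure_mixture hh
  have h1 := integral_ratio_sq_le H.measurable_k H.pos_k H.integrable_ratio hg hh θ
  exact ((memLp_two_iff_integrable_sq ((H.measurable_k θ).div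
    (Measurable.mixture H.measurable_k g)).aestronglyMeasurable).2 h1.1).integrable one_le_two

lemma integral_ratio_sub_one_sq (H : DeconvolutionAssumptions k fZ C) (hg : g ∈ openSimplex Θ)
    (hh : h ∈ openSimplex Θ) (θ : Θ) :
    Integrable (fun p : ℝ × ℝ => (k θ p.1 / mixture k g p.1 - 1) ^ 2) (stepMeasure k fZ h) ∧
      ∫ p, (k θ p.1 / mixture k g p.1 - 1) ^ 2 ∂(stepMeasure k fZ h) ≤ ratioBound k + 1 := by
  have := H.isProbabilityMeasure_step hh
  have h1 := integral_ratio_sq_le H.measurable_k H.pos_k H.integrable_ratio hg hh θ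
  have h2 := (H.measurePreserving_fst (h := h)).integral_comp_of_integrable h1.1
  have h3 := (H.measurePreserving_fst (h := h)).integral_comp_of_integrable
    (H.integrable_ratio_mixture hg hh θ)
  exact integral_sub_one_sq_le h3.1 h2.1
    (fun p => (div_pos (H.pos_k θ _) (mixture_pos H.pos_k hg _)).le) (h2.2.trans_le h1.2)

lemma mixtureSqNorm_le (H : DeconvolutionAssumptions k fZ C) (hg : g ∈ openSimplex Θ)
    (hh : h ∈ openSimplex Θ) :
    mixtureSqNorm k (h - g) / C ≤
      ∑ θ, h θ * (∫ p, k θ p.1 / mixture k g p.1 ∂(stepMeasure k fZ h) - 1) := by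
  have h1 := mixtureSqNorm_le_integral_ratio H.measurable_k H.pos_k H.isDensity_k H.le_k hg hh
    (H.integrable_ratio_mixture hg hh)
  simpa only [((H.measurePreserving_fst (h := h)).integral_comp_of_integrable
    (H.integrable_ratio_mixture hg hh _)).2] using h1

/-- Conditional drift of the negative logarithm of the noisy estimate. -/
lemma integral_neg_log_step_le (H : DeconvolutionAssumptions k fZ C) (hh : h ∈ openSimplex Θ)
    (ha : a ∈ Set.Ioo (0 : ℝ) 1) (θ : Θ) :
    ∫ p, -Real.log (newtonStep (noisyKernel fZ k) a h (p.1 + p.2) θ) ∂(stepMeasure k fZ h)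
      ≤ -Real.log (h θ) + a ^ 2 / (1 - a) * (ratioBound k + 1) := by
  have := H.isProbabilityMeasure_step hh
  obtain ⟨i1, e1⟩ := H.integral_noisy_ratio hh θ
  obtain ⟨i2, e2⟩ := H.integral_noisy_ratio_sub_one_sq hh θ
  have h1 : 0 < 1 - a := by linarith [ha.2]
  have i3 := (i1.sub (integrable_const (1 : ℝ))).const_mul a
  have i4 := i2.const_mul (a ^ 2 / (1 - a))
  have i5 := (integrable_const (μ := stepMeasure k fZ h) (-Real.log (h θ))).sub i3
  refine (integral_mono_of_nonneg (Eventually.of_forall fun p => ?_) (i5.add i4)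
    (Eventually.of_forall fun p => neg_log_newtonStep_le H.pos_noisy hh ha _ θ)).trans ?_
  · have hs := newtonStep_mem H.pos_noisy hh ha (p.1 + p.2)
    exact neg_nonneg.2 (Real.log_nonpos (hs.1 θ).le (openSimplex.le_one hs θ))
  -- By `e1` the linear term integrates to zero, and only the quadratic remainder is left.
  · rw [integral_add' i5 i4, integral_sub' (integrable_const _) i3, integral_const_mul,
      integral_const_mul, integral_sub' i1 (integrable_const _), e1]
    have h2 : 0 ≤ a ^ 2 / (1 - a) := by positivity
    simpa using mul_le_mul_of_nonneg_left e2 h2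

/-- The contribution of one `θ`, with `l = -log (g θ)` and `r`, `q` the oracle and noisy ratios. The
two first-order moves are correlated, as `Y` contains `X`, so their product need not average out; it
is absorbed by `-x * y ≤ x ^ 2 + y ^ 2` and `|p₀ - h₀| ≤ 1`. -/
lemma crossEntropy_term_le {u h₀ p₀ r q l : ℝ} (ha : a ∈ Set.Ioo (0 : ℝ) 1)
    (hu : u = (1 - b) * h₀ + b * p₀) (hp : p₀ = h₀ * q) (hh0 : 0 ≤ h₀) (hh1 : h₀ ≤ 1)
    (hp0 : 0 ≤ p₀) (hp1 : p₀ ≤ 1) (hu0 : 0 ≤ u) (hu1 : u ≤ 1) {l' : ℝ}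
    (hl : l' ≤ l - a * (r - 1) + a ^ 2 / (1 - a) * (r - 1) ^ 2) :
    u * l' ≤ h₀ * l + b * (h₀ * l) * (q - 1) - a * h₀ * (r - 1) + b ^ 2
      + (a ^ 2 + a ^ 2 / (1 - a)) * (r - 1) ^ 2 := by
  have h1 : 0 < 1 - a := by linarith [ha.2]
  have h2 : 0 ≤ a ^ 2 / (1 - a) * (r - 1) ^ 2 := by positivity
  have h3 := mul_le_mul_of_nonneg_left hl hu0
  have h4 := mul_le_mul_of_nonneg_right hu1 h2
  have h5 : (p₀ - h₀) ^ 2 ≤ 1 := by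
    rw [sq_le_one_iff_abs_le_one, abs_le]; constructor <;> linarith
  have h6 : -(b * (p₀ - h₀)) * (a * (r - 1)) ≤ b ^ 2 + a ^ 2 * (r - 1) ^ 2 := by
    nlinarith [sq_nonneg (b * (p₀ - h₀) + a * (r - 1)), mul_le_mul_of_nonneg_left h5 (sq_nonneg b),
      sq_nonneg (b * (p₀ - h₀)), sq_nonneg (a * (r - 1))]
  have e : u * (l - a * (r - 1) + a ^ 2 / (1 - a) * (r - 1) ^ 2)
      = h₀ * l + b * (h₀ * l) * (q - 1) - a * h₀ * (r - 1) + -(b * (p₀ - h₀)) * (a * (r - 1))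
        + u * (a ^ 2 / (1 - a) * (r - 1) ^ 2) := by
    rw [hu, hp]; ring
  linarith

/-- Conditional drift of the cross entropy of the two estimates. -/
lemma integral_crossEntropy_step_le (H : DeconvolutionAssumptions k fZ C) (hg : g ∈ openSimplex Θ)
    (hh : h ∈ openSimplex Θ) (ha : a ∈ Set.Ioo (0 : ℝ) 1) (hb : b ∈ Set.Ioo (0 : ℝ) 1) :
    ∫ p, -∑ θ, newtonStep (noisyKernel fZ k) b h (p.1 + p.2) θ
        * Real.log (newtonStep k a g p.1 θ) ∂(stepMeasure k fZ h)
      ≤ -∑ θ, h θ * Real.log (g θ) - a * (mixtureSqNorm k (h - g) / C)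
        + Fintype.card Θ * (b ^ 2 + (a ^ 2 + a ^ 2 / (1 - a)) * (ratioBound k + 1)) := by
  have := H.isProbabilityMeasure_step hh
  have h1 : 0 < 1 - a := by linarith [ha.2]
  set μ := stepMeasure k fZ h with hμ
  set c := a ^ 2 + a ^ 2 / (1 - a) with hc
  have hc0 : 0 ≤ c := by positivity
  -- The majorant from `crossEntropy_term_le`. Its term linear in `b` has mean zero; the one linear
  -- in `a` is the drift.
  set T : Θ → ℝ × ℝ → ℝ := fun θ p => h θ * -Real.log (g θ)
    + b * (h θ * -Real.log (g θ)) * (noisyKernel fZ k θ (p.1 + p.2)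
        / mixture (noisyKernel fZ k) h (p.1 + p.2) - 1)
    - a * h θ * (k θ p.1 / mixture k g p.1 - 1) + b ^ 2
    + c * (k θ p.1 / mixture k g p.1 - 1) ^ 2 with hT
  have hTi : ∀ θ, Integrable (T θ) μ ∧ ∫ p, T θ p ∂μ = h θ * -Real.log (g θ)
      - a * (h θ * (∫ p, k θ p.1 / mixture k g p.1 ∂μ - 1)) + b ^ 2
      + c * ∫ p, (k θ p.1 / mixture k g p.1 - 1) ^ 2 ∂μ := by
    intro θ
    obtain ⟨i1, e1⟩ := H.integral_noisy_ratio hh θ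
    have i2 := ((H.measurePreserving_fst (h := h)).integral_comp_of_integrable
      (H.integrable_ratio_mixture hg hh θ)).1
    have j1 : Integrable (fun p : ℝ × ℝ => b * (h θ * -Real.log (g θ)) *
        (noisyKernel fZ k θ (p.1 + p.2) / mixture (noisyKernel fZ k) h (p.1 + p.2) - 1)) μ :=
      (i1.sub (integrable_const (1 : ℝ))).const_mul _
    have j2 : Integrable (fun p : ℝ × ℝ => a * h θ * (k θ p.1 / mixture k g p.1 - 1)) μ :=
      (i2.sub (integrable_const (1 : ℝ))).const_mul _
    have j3 := (H.integral_ratio_sub_one_sq hg hh θ).1.const_mul c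
    have j0 := integrable_const (μ := μ) (h θ * -Real.log (g θ))
    have jb := integrable_const (μ := μ) (b ^ 2)
    refine ⟨(((j0.add j1).sub j2).add jb).add j3, ?_⟩
    have e : T θ = (((fun _ => h θ * -Real.log (g θ)) + _ - _) + fun _ => b ^ 2) + _ := rfl
    rw [e, integral_add' (((j0.add j1).sub j2).add jb) j3, integral_add' ((j0.add j1).sub j2) jb,
      integral_sub' (j0.add j1) j2, integral_add' j0 j1]
    simp only [integral_const_mul]
    rw [integral_sub i1 (integrable_const _), integral_sub i2 (integrable_const _), e1]
    simp only [integral_const, probReal_univ, one_smul, ← hμ]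
    ring
  have hle : ∫ p, -∑ θ, newtonStep (noisyKernel fZ k) b h (p.1 + p.2) θ
        * Real.log (newtonStep k a g p.1 θ) ∂μ ≤ ∫ p, ∑ θ, T θ p ∂μ := by
    refine integral_mono_of_nonneg (Eventually.of_forall fun p => ?_)
      (integrable_finsetSum _ fun θ _ => (hTi θ).1) (Eventually.of_forall fun p => ?_)
    · have hs := newtonStep_mem H.pos_noisy hh hb (p.1 + p.2)
      have hs' := newtonStep_mem H.pos_k hg ha p.1
      exact neg_nonneg.2 (Finset.sum_nonpos fun θ _ => mul_nonpos_of_nonneg_of_nonpos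
        (hs.1 θ).le (Real.log_nonpos (hs'.1 θ).le (openSimplex.le_one hs' θ)))
    · have hs := newtonStep_mem H.pos_noisy hh hb (p.1 + p.2)
      have hp := posterior_mem H.pos_noisy hh (p.1 + p.2)
      simp only [← Finset.sum_neg_distrib, ← mul_neg]
      refine Finset.sum_le_sum fun θ _ => ?_
      exact crossEntropy_term_le ha rfl (posterior_eq_mul _ _ _ _) (hh.1 θ).le
        (openSimplex.le_one hh θ) (hp.1 θ).le (openSimplex.le_one hp θ) (hs.1 θ).le
        (openSimplex.le_one hs θ) (neg_log_newtonStep_le H.pos_k hg ha p.1 θ)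
  refine hle.trans ?_
  rw [integral_finsetSum _ fun θ _ => (hTi θ).1]
  simp only [(hTi _).2]
  have hd := mul_le_mul_of_nonneg_left (H.mixtureSqNorm_le hg hh) ha.1.le
  have hs : ∑ θ, ∫ p, (k θ p.1 / mixture k g p.1 - 1) ^ 2 ∂μ
      ≤ Fintype.card Θ * (ratioBound k + 1) := by
    calc _ ≤ ∑ _θ : Θ, (ratioBound k + 1) :=
          Finset.sum_le_sum fun θ _ => (H.integral_ratio_sub_one_sq hg hh θ).2
      _ = _ := by rw [Finset.sum_const, Finset.card_univ, nsmul_eq_mul]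
  have hs2 := mul_le_mul_of_nonneg_left hs hc0
  simp only [Finset.sum_add_distrib, Finset.sum_sub_distrib, ← Finset.mul_sum, mul_neg,
    Finset.sum_neg_distrib, Finset.sum_const, Finset.card_univ, nsmul_eq_mul]
  linarith

end DeconvolutionAssumptions

/-! ### Joint law of the past, the next signal and the next noise. -/

section Kernel

variable {Θ : Type*} [Fintype Θ] {k : Θ → ℝ → ℝ} {fZ : ℝ → ℝ}

/-- The kernel giving the law of the next signal and noise, given the current pair of estimates. -/
noncomputable def stepKernel (k : Θ → ℝ → ℝ) (fZ : ℝ → ℝ) :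
    Kernel ((Θ → ℝ) × (Θ → ℝ)) (ℝ × ℝ) :=
  ((Kernel.const _ volume).withDensity fun s x => ENNReal.ofReal (mixture k s.2 x))
    ×ₖ Kernel.const _ (densityMeasure fZ)

/-- The weights range over all of `Θ → ℝ`, where the mixture need not have mass one, so only
s-finiteness is available. -/
lemma isSFiniteKernel_mixture (k : Θ → ℝ → ℝ) : IsSFiniteKernel
    ((Kernel.const ((Θ → ℝ) × (Θ → ℝ)) (volume : Measure ℝ)).withDensity
      fun s x => ENNReal.ofReal (mixture k s.2 x)) :=
  Kernel.IsSFiniteKernel.withDensity _ fun _ _ => ENNReal.ofReal_ne_top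

instance instIsSFiniteKernelStepKernel (k : Θ → ℝ → ℝ) (fZ : ℝ → ℝ) :
    IsSFiniteKernel (stepKernel k fZ) := by
  unfold stepKernel densityMeasure
  infer_instance

lemma stepKernel_apply (hm : ∀ θ, Measurable (k θ)) (fZ : ℝ → ℝ) (s : (Θ → ℝ) × (Θ → ℝ)) :
    stepKernel k fZ s = stepMeasure k fZ s.2 := by
  have := isSFiniteKernel_mixture k
  have : SFinite (densityMeasure fZ) := by unfold densityMeasure; infer_instance
  have hmeas : Measurable (Function.uncurry fun (s : (Θ → ℝ) × (Θ → ℝ)) (x : ℝ) =>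
      ENNReal.ofReal (mixture k s.2 x)) :=
    ((measurable_mixture hm).comp
      ((measurable_snd.comp measurable_fst).prodMk measurable_snd)).ennreal_ofReal
  rw [stepKernel, Kernel.prod_apply, Kernel.const_apply, Kernel.withDensity_apply _ hmeas,
    Kernel.const_apply]
  rfl

end Kernel

section Past

variable {Ω : Type*} {X Y Z : ℕ → Ω → ℝ}

lemma past_mono : Monotone (past X Y Z) := fun _ _ hmn =>
  biSup_mono fun _ hi => Finset.Icc_subset_Icc_right hmn hi

lemma comap_le_past {n : ℕ} (hn : 1 ≤ n) :
    (MeasurableSpace.comap (X n) (borel ℝ) ⊔ MeasurableSpace.comap (Y n) (borel ℝ)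
      ⊔ MeasurableSpace.comap (Z n) (borel ℝ)) ≤ past X Y Z n :=
  le_biSup (fun i => MeasurableSpace.comap (X i) (borel ℝ) ⊔ MeasurableSpace.comap (Y i) (borel ℝ)
      ⊔ MeasurableSpace.comap (Z i) (borel ℝ)) (Finset.mem_Icc.2 ⟨hn, le_rfl⟩)

lemma measurable_X_past {n : ℕ} (hn : 1 ≤ n) : Measurable[past X Y Z n] (X n) :=
  measurable_iff_comap_le.2 ((le_sup_left.trans le_sup_left).trans (comap_le_past hn))

lemma measurable_Y_past {n : ℕ} (hn : 1 ≤ n) : Measurable[past X Y Z n] (Y n) :=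
  measurable_iff_comap_le.2 ((le_sup_right.trans le_sup_left).trans (comap_le_past hn))

end Past

namespace IsDeconvolutionModel

variable {Ω Θ : Type*} [mΩ : MeasurableSpace Ω] [Fintype Θ] {P : Measure Ω}
  {k : Θ → ℝ → ℝ} {fZ : ℝ → ℝ} {αt : ℕ → ℝ} {g₀ : Θ → ℝ}
  {X Y Z : ℕ → Ω → ℝ} {C : ℝ}

lemma past_le (M : IsDeconvolutionModel P k fZ αt g₀ X Y Z) (n : ℕ) : past X Y Z n ≤ mΩ :=
  iSup₂_le fun i hi =>
    have h1 := (Finset.mem_Icc.1 hi).1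
    sup_le (sup_le (measurable_iff_comap_le.1 (M.measurable_X i h1))
      (measurable_iff_comap_le.1 (M.measurable_Y i h1)))
      (measurable_iff_comap_le.1 (M.measurable_Z i h1))

/-- The filtration of the observed past. -/
def pastFiltration (M : IsDeconvolutionModel P k fZ αt g₀ X Y Z) : Filtration ℕ mΩ where
  seq := past X Y Z
  mono' := past_mono
  le' := M.past_le

variable [IsProbabilityMeasure P]

/-- Integrating the conditional law over a past event converts the almost sure identity into one
between measures, the form needed to identify the joint law. -/
lemma measure_inter_preimage_X (M : IsDeconvolutionModel P k fZ αt g₀ X Y Z)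
    (H : DeconvolutionAssumptions k fZ C) (n : ℕ) {A : Set Ω} (hA : MeasurableSet[past X Y Z n] A)
    {t : Set ℝ} (ht : MeasurableSet t)
    (hmem : ∀ ω, newton (noisyKernel fZ k) αt g₀ (fun i => Y i ω) n ∈ openSimplex Θ) :
    P (A ∩ X (n + 1) ⁻¹' t) = ∫⁻ ω in A, densityMeasure
      (mixture k (newton (noisyKernel fZ k) αt g₀ (fun i => Y i ω) n)) t ∂P := by
  have hB : MeasurableSet (X (n + 1) ⁻¹' t) := M.measurable_X (n + 1) (by omega) ht
  have hAm : MeasurableSet A := M.past_le n A hA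
  have hind : Integrable ((X (n + 1) ⁻¹' t).indicator fun _ => (1 : ℝ)) P :=
    (integrable_const 1).indicator hB
  have h1 := setIntegral_condExp (M.past_le n) hind hA
  have h2 := M.condLaw_X n t ht
  rw [integral_congr_ae (ae_restrict_of_ae h2), integral_indicator_const _ hB, smul_eq_mul, mul_one,
    measureReal_restrict_apply hB] at h1
  have hI : Integrable (fun ω => ∫ x in t, mixture k
      (newton (noisyKernel fZ k) αt g₀ (fun i => Y i ω) n) x) P :=
    (integrable_congr h2).1 integrable_condExp
  have hd : ∀ ω, IsDensity (mixture k (newton (noisyKernel fZ k) αt g₀ (fun i => Y i ω) n)) :=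
    fun ω => IsDensity.mixture H.isDensity_k (openSimplex.mem_stdSimplex (hmem ω))
  have h3 := ofReal_integral_eq_lintegral_ofReal hI.restrict (μ := P.restrict A)
    (Eventually.of_forall fun ω => integral_nonneg (hd ω).1)
  rw [h1, Set.inter_comm, ofReal_measureReal] at h3
  rw [h3]
  refine lintegral_congr fun ω => ?_
  rw [densityMeasure, withDensity_apply _ ht, ofReal_integral_eq_lintegral_ofReal
    (hd ω).2.1.integrableOn (Eventually.of_forall (hd ω).1)]

variable {S : Ω → (Θ → ℝ) × (Θ → ℝ)}

/-- The joint law of past-measurable estimates and of the next signal and noise. -/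
lemma map_restrict_eq_compProd (M : IsDeconvolutionModel P k fZ αt g₀ X Y Z)
    (H : DeconvolutionAssumptions k fZ C) (n : ℕ) {A : Set Ω} (hA : MeasurableSet[past X Y Z n] A)
    (hS : Measurable[past X Y Z n] S)
    (hS2 : ∀ ω, (S ω).2 = newton (noisyKernel fZ k) αt g₀ (fun i => Y i ω) n)
    (hmem : ∀ ω, (S ω).2 ∈ openSimplex Θ) :
    (P.restrict A).map (fun ω => (S ω, (X (n + 1) ω, Z (n + 1) ω)))
      = (P.restrict A).map S ⊗ₘ stepKernel k fZ := by
  have hX := M.measurable_X (n + 1) (by omega)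
  have hZ := M.measurable_Z (n + 1) (by omega)
  have hSm : Measurable S := hS.mono (M.past_le n) le_rfl
  have hJ : Measurable fun ω => (S ω, (X (n + 1) ω, Z (n + 1) ω)) := hSm.prodMk (hX.prodMk hZ)
  have := H.isDensity_fZ.isProbabilityMeasure
  have hprob : IsFiniteMeasure
      ((P.restrict A).map (fun ω => (S ω, (X (n + 1) ω, Z (n + 1) ω)))) := inferInstance
  refine Measure.ext_prod₃ fun {s t u} hs ht hu => ?_
  have hA' : MeasurableSet[past X Y Z n] (A ∩ S ⁻¹' s) :=
    @MeasurableSet.inter _ (past X Y Z n) _ _ hA (hS hs)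
  have hXt : MeasurableSet[past X Y Z n ⊔ MeasurableSpace.comap (X (n + 1)) (borel ℝ)]
      ((A ∩ S ⁻¹' s) ∩ X (n + 1) ⁻¹' t) :=
    @MeasurableSet.inter _ (_ ⊔ _) _ _ ((le_sup_left : past X Y Z n ≤ _) _ hA')
      ((le_sup_right : MeasurableSpace.comap (X (n + 1)) (borel ℝ) ≤ _) _ ⟨t, ht, rfl⟩)
  -- The event on the past and on `X (n + 1)` lies in the sigma-algebra independent of `Z (n + 1)`,
  -- so the probability of the rectangle factors.
  have hind := (Indep_iff _ _ P).1 (M.indep_Z n) (Z (n + 1) ⁻¹' u) _ ⟨u, hu, rfl⟩ hXt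
  have hZu : P (Z (n + 1) ⁻¹' u) = densityMeasure fZ u := by
    rw [← Measure.map_apply hZ hu, M.law_Z (n + 1) (by omega)]; rfl
  have hpre : (fun ω => (S ω, (X (n + 1) ω, Z (n + 1) ω))) ⁻¹' (s ×ˢ t ×ˢ u) ∩ A
      = Z (n + 1) ⁻¹' u ∩ ((A ∩ S ⁻¹' s) ∩ X (n + 1) ⁻¹' t) := by
    ext ω
    simp only [Set.mem_inter_iff, Set.mem_preimage, Set.mem_prod]
    tauto
  rw [Measure.map_apply hJ (hs.prod (ht.prod hu)),
    Measure.restrict_apply (hJ (hs.prod (ht.prod hu))), hpre, hind, hZu,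
    M.measure_inter_preimage_X H n hA' ht fun ω => hS2 ω ▸ hmem ω,
    Measure.compProd_apply_prod hs (ht.prod hu),
    setLIntegral_map hs (Kernel.measurable_coe _ (ht.prod hu)) hSm,
    Measure.restrict_restrict (hSm hs), Set.inter_comm (S ⁻¹' s) A]
  rw [← lintegral_const_mul' _ _ (measure_ne_top _ _)]
  refine lintegral_congr fun ω => ?_
  rw [stepKernel_apply H.measurable_k, stepMeasure, Measure.prod_prod, mul_comm, hS2]

/-- An upper bound for the one-step conditional mean is one for the integral over past events. -/
lemma setIntegral_step_le (M : IsDeconvolutionModel P k fZ αt g₀ X Y Z)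
    (H : DeconvolutionAssumptions k fZ C) (n : ℕ) {A : Set Ω} (hA : MeasurableSet[past X Y Z n] A)
    (hS : Measurable[past X Y Z n] S)
    (hS2 : ∀ ω, (S ω).2 = newton (noisyKernel fZ k) αt g₀ (fun i => Y i ω) n)
    (hmem : ∀ ω, (S ω).2 ∈ openSimplex Θ) {Φ : ((Θ → ℝ) × (Θ → ℝ)) × (ℝ × ℝ) → ℝ}
    (hΦ : Measurable Φ) (hΦi : Integrable (fun ω => Φ (S ω, (X (n + 1) ω, Z (n + 1) ω))) P)
    {Ψ : Ω → ℝ} (hΨ : Integrable Ψ P)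
    (hle : ∀ ω, ∫ p, Φ (S ω, p) ∂(stepMeasure k fZ (S ω).2) ≤ Ψ ω) :
    ∫ ω in A, Φ (S ω, (X (n + 1) ω, Z (n + 1) ω)) ∂P ≤ ∫ ω in A, Ψ ω ∂P := by
  have hX := M.measurable_X (n + 1) (by omega)
  have hZ := M.measurable_Z (n + 1) (by omega)
  have hSm : Measurable S := hS.mono (M.past_le n) le_rfl
  have hJ : Measurable fun ω => (S ω, (X (n + 1) ω, Z (n + 1) ω)) := hSm.prodMk (hX.prodMk hZ)
  have hlaw := M.map_restrict_eq_compProd H n hA hS hS2 hmem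
  have hi : Integrable Φ ((P.restrict A).map S ⊗ₘ stepKernel k fZ) := by
    rw [← hlaw, integrable_map_measure hΦ.aestronglyMeasurable hJ.aemeasurable]
    exact hΦi.restrict
  have hinner : Integrable (fun s => ∫ p, Φ (s, p) ∂(stepKernel k fZ s)) ((P.restrict A).map S) := by
    have h := hi
    rw [Measure.compProd] at h
    simpa using h.integral_compProd
  rw [← integral_map (φ := fun ω => (S ω, (X (n + 1) ω, Z (n + 1) ω))) hJ.aemeasurable
    hΦ.aestronglyMeasurable, hlaw, Measure.integral_compProd hi,
    integral_map hSm.aemeasurable hinner.aestronglyMeasurable]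
  refine integral_mono (hinner.comp_measurable hSm) hΨ.restrict fun ω => ?_
  simp only [stepKernel_apply H.measurable_k]
  exact hle ω

end IsDeconvolutionModel

/-! ### Almost sure convergence of the two estimates. -/

/-- Square summability forces the rates to zero, so eventually `1 - a (n + 1) ≥ 1 / 2` and the
quotient is at most twice the square. -/
lemma IsLearningRate.summable_sq_div {a : ℕ → ℝ} (ha : IsLearningRate a) :
    Summable fun n => a (n + 1) ^ 2 / (1 - a (n + 1)) := by
  refine (ha.summable_sq.mul_left 2).of_norm_bounded_eventually_nat ?_
  have h0 := ha.summable_sq.tendsto_atTop_zero.eventually_lt_const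
    (show (0 : ℝ) < (1 / 2) ^ 2 by norm_num)
  filter_upwards [h0] with n hn
  obtain ⟨h1, h2⟩ := ha.mem_Ioo (n + 1) (by omega)
  have h3 : a (n + 1) < 1 / 2 := lt_of_pow_lt_pow_left₀ 2 (by norm_num) hn
  have h4 : 0 < 1 - a (n + 1) := by linarith
  rw [Real.norm_of_nonneg (by positivity), div_le_iff₀ h4]
  nlinarith [sq_nonneg (a (n + 1))]

lemma ratioBound_nonneg {Θ : Type*} [Fintype Θ] {k : Θ → ℝ → ℝ} (hpos : ∀ θ x, 0 < k θ x) :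
    0 ≤ ratioBound k :=
  Finset.sum_nonneg fun _ _ => Finset.sum_nonneg fun _ _ => Finset.sum_nonneg fun θ₃ _ =>
    integral_nonneg fun x => mul_nonneg (by positivity) (hpos θ₃ x).le

lemma tendsto_iSup_abs_sub {Θ : Type*} [Fintype Θ] {p q : ℕ → Θ → ℝ} {h : Θ → ℝ}
    (hp : Tendsto p atTop (𝓝 h)) (hq : Tendsto q atTop (𝓝 h)) :
    Tendsto (fun n => ⨆ θ, |p n θ - q n θ|) atTop (𝓝 0) := by
  have h1 : Tendsto (fun n => ∑ θ, |p n θ - q n θ|) atTop (𝓝 0) := by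
    have := tendsto_finsetSum Finset.univ fun θ (_ : θ ∈ Finset.univ) =>
      ((tendsto_pi_nhds.1 hp θ).sub (tendsto_pi_nhds.1 hq θ)).abs
    simpa using this
  refine squeeze_zero (fun n => Real.iSup_nonneg fun θ => abs_nonneg _) (fun n => ?_) h1
  exact Real.iSup_le (fun θ => Finset.single_le_sum (f := fun θ => |p n θ - q n θ|)
    (fun i _ => abs_nonneg _) (Finset.mem_univ θ)) (Finset.sum_nonneg fun θ _ => abs_nonneg _)

lemma measurable_crossEntropy {Ω Θ : Type*} {m : MeasurableSpace Ω} [Fintype Θ]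
    {p q : Ω → Θ → ℝ} (hp : Measurable p) (hq : Measurable q) :
    Measurable fun ω => -∑ θ, p ω θ * Real.log (q ω θ) :=
  (Finset.measurable_fun_sum _ fun θ _ => ((measurable_pi_apply θ).comp hp).mul
    ((measurable_pi_apply θ).comp hq).log).neg

lemma crossEntropy_nonneg {Θ : Type*} [Fintype Θ] {p q : Θ → ℝ} (hp : p ∈ openSimplex Θ)
    (hq : q ∈ openSimplex Θ) : 0 ≤ -∑ θ, p θ * Real.log (q θ) :=
  neg_nonneg.2 (Finset.sum_nonpos fun θ _ => mul_nonpos_of_nonneg_of_nonpos (hp.1 θ).le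
    (Real.log_nonpos (hq.1 θ).le (openSimplex.le_one hq θ)))

namespace IsDeconvolutionModel

variable {Ω Θ : Type*} [mΩ : MeasurableSpace Ω] [Fintype Θ] {P : Measure Ω}
  {k : Θ → ℝ → ℝ} {fZ : ℝ → ℝ} {α αt : ℕ → ℝ} {g₀ : Θ → ℝ}
  {X Y Z : ℕ → Ω → ℝ} {C : ℝ}

lemma measurable_oracle (M : IsDeconvolutionModel P k fZ αt g₀ X Y Z)
    (H : DeconvolutionAssumptions k fZ C) (α : ℕ → ℝ) (n : ℕ) :
    Measurable[M.pastFiltration n] fun ω => newton k α g₀ (fun i => X i ω) n :=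
  measurable_newton (past X Y Z) past_mono H.measurable_k α g₀ X
    (fun _ hn => measurable_X_past hn) n

lemma measurable_noisy (M : IsDeconvolutionModel P k fZ αt g₀ X Y Z)
    (H : DeconvolutionAssumptions k fZ C) (n : ℕ) :
    Measurable[M.pastFiltration n] fun ω =>
      newton (noisyKernel fZ k) αt g₀ (fun i => Y i ω) n :=
  measurable_newton (past X Y Z) past_mono H.measurable_noisy αt g₀ Y
    (fun _ hn => measurable_Y_past hn) n

variable [IsProbabilityMeasure P]

/-- The noisy estimates stay almost surely away from the boundary of the simplex. -/
lemma ae_tendsto_neg_log_noisy (M : IsDeconvolutionModel P k fZ αt g₀ X Y Z)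
    (H : DeconvolutionAssumptions k fZ C) (hg₀ : g₀ ∈ openSimplex Θ) (hαt : IsLearningRate αt)
    (θ : Θ) : ∀ᵐ ω ∂P, ∃ l, Tendsto (fun n =>
      -Real.log (newton (noisyKernel fZ k) αt g₀ (fun i => Y i ω) n θ)) atTop (𝓝 l) := by
  have hmem : ∀ n ω, newton (noisyKernel fZ k) αt g₀ (fun i => Y i ω) n ∈ openSimplex Θ :=
    fun n ω => newton_mem H.pos_noisy hg₀ hαt.mem_Ioo _ n
  have hm : ∀ n, Measurable[M.pastFiltration n] fun ω =>
      -Real.log (newton (noisyKernel fZ k) αt g₀ (fun i => Y i ω) n θ) := fun n =>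
    ((measurable_pi_apply θ).comp (M.measurable_noisy H n)).log.neg
  have h0 : ∀ n ω, 0 ≤ -Real.log (newton (noisyKernel fZ k) αt g₀ (fun i => Y i ω) n θ) :=
    fun n ω => neg_nonneg.2
      (Real.log_nonpos ((hmem n ω).1 θ).le (openSimplex.le_one (hmem n ω) θ))
  have hi : ∀ n, Integrable (fun ω =>
      -Real.log (newton (noisyKernel fZ k) αt g₀ (fun i => Y i ω) n θ)) P := by
    intro n
    -- For fixed `n` the estimate has a positive lower bound independent of the data, so its
    -- logarithm is bounded and hence integrable.
    obtain ⟨c, hc, hle⟩ := exists_le_newton H.pos_noisy hg₀ hαt.mem_Ioo n θ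
    refine Integrable.of_bound ((hm n).mono (M.past_le n) le_rfl).aestronglyMeasurable
      (-Real.log c) (Eventually.of_forall fun ω => ?_)
    rw [Real.norm_of_nonneg (h0 n ω)]
    exact neg_le_neg (Real.log_le_log hc (hle _))
  have hpos : ∀ n, 0 < 1 - αt (n + 1) := fun n => by
    linarith [(hαt.mem_Ioo (n + 1) (by omega)).2]
  have hR := ratioBound_nonneg H.pos_k
  have key := almostSupermartingale_tendsto (P := P) (ℱ := M.pastFiltration) (D := fun _ _ => 0)
    (c := fun n => αt (n + 1) ^ 2 / (1 - αt (n + 1)) * (ratioBound k + 1))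
    hm (fun n => @measurable_const _ _ _ (M.pastFiltration n) _) hi (fun n => integrable_const _)
    h0 (fun _ _ => le_rfl)
    (fun n => mul_nonneg (div_nonneg (sq_nonneg _) (hpos n).le) (by linarith))
    (hαt.summable_sq_div.mul_right _) ?_
  · filter_upwards [key] with ω hω using hω.1
  intro n A hA
  have hnext : ∀ ω, newton (noisyKernel fZ k) αt g₀ (fun i => Y i ω) (n + 1)
      = newtonStep (noisyKernel fZ k) (αt (n + 1))
        (newton (noisyKernel fZ k) αt g₀ (fun i => Y i ω) n) (X (n + 1) ω + Z (n + 1) ω) :=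
    fun ω => by rw [newton_succ, M.Y_eq (n + 1) (by omega)]
  have hi1 := hi (n + 1)
  simp only [hnext] at hi1 ⊢
  refine M.setIntegral_step_le H n hA
    -- The oracle slot is a dummy here: the drift involves the noisy estimate alone.
    (S := fun ω => (g₀, newton (noisyKernel fZ k) αt g₀ (fun i => Y i ω) n))
    (Measurable.prodMk (@measurable_const _ _ _ (past X Y Z n) _) (M.measurable_noisy H n))
    (fun ω => rfl) (hmem n)
    (Φ := fun q => -Real.log
      (newtonStep (noisyKernel fZ k) (αt (n + 1)) q.1.2 (q.2.1 + q.2.2) θ)) ?_ hi1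
    (((hi n).sub (integrable_const _)).add (integrable_const _)) fun ω => ?_
  · exact ((measurable_pi_apply θ).comp ((measurable_newtonStep H.measurable_noisy _).comp
      ((measurable_snd.comp measurable_fst).prodMk
        ((measurable_fst.comp measurable_snd).add (measurable_snd.comp measurable_snd))))).log.neg
  · rw [sub_zero]
    exact H.integral_neg_log_step_le (hmem n ω) (hαt.mem_Ioo (n + 1) (by omega)) θ

/-- Continuity on a compact product of simplices; it makes the decrement of the almost
supermartingale integrable. -/
lemma exists_mixtureSqNorm_sub_le (H : DeconvolutionAssumptions k fZ C) :
    ∃ B, ∀ g ∈ openSimplex Θ, ∀ h ∈ openSimplex Θ, mixtureSqNorm k (h - g) ≤ B := by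
  have hc : Continuous fun p : (Θ → ℝ) × (Θ → ℝ) => mixtureSqNorm k (p.2 - p.1) :=
    (continuous_mixtureSqNorm H.measurable_k H.pos_k H.isDensity_k ⟨C, H.le_k⟩).comp
      (continuous_snd.sub continuous_fst)
  obtain ⟨B, hB⟩ := ((isCompact_stdSimplex ℝ Θ).prod (isCompact_stdSimplex ℝ Θ)).bddAbove_image
    hc.continuousOn
  exact ⟨B, fun g hg h hh => hB ⟨(g, h), ⟨openSimplex.mem_stdSimplex hg,
    openSimplex.mem_stdSimplex hh⟩, rfl⟩⟩

/-- The cross entropy of the two estimates converges, and their mixtures are close in `L²` along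
the learning rates. -/
lemma ae_tendsto_crossEntropy (M : IsDeconvolutionModel P k fZ αt g₀ X Y Z)
    (H : DeconvolutionAssumptions k fZ C) (hC : 0 < C) (hg₀ : g₀ ∈ openSimplex Θ)
    (hα : IsLearningRate α) (hαt : IsLearningRate αt) :
    ∀ᵐ ω ∂P, (∃ l, Tendsto (fun n =>
      -∑ θ, newton (noisyKernel fZ k) αt g₀ (fun i => Y i ω) n θ
        * Real.log (newton k α g₀ (fun i => X i ω) n θ)) atTop (𝓝 l)) ∧
      Summable fun n => α (n + 1) * (mixtureSqNorm k
        (newton (noisyKernel fZ k) αt g₀ (fun i => Y i ω) n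
          - newton k α g₀ (fun i => X i ω) n) / C) := by
  have hmem : ∀ n ω, newton (noisyKernel fZ k) αt g₀ (fun i => Y i ω) n ∈ openSimplex Θ :=
    fun n ω => newton_mem H.pos_noisy hg₀ hαt.mem_Ioo _ n
  have hmem' : ∀ n ω, newton k α g₀ (fun i => X i ω) n ∈ openSimplex Θ :=
    fun n ω => newton_mem H.pos_k hg₀ hα.mem_Ioo _ n
  have hα0 : ∀ n, 0 < α (n + 1) := fun n => (hα.mem_Ioo (n + 1) (by omega)).1
  have hm := fun n => measurable_crossEntropy (M.measurable_noisy H n) (M.measurable_oracle H α n)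
  have h0 := fun n ω => crossEntropy_nonneg (hmem n ω) (hmem' n ω)
  have hi : ∀ n, Integrable (fun ω =>
      -∑ θ, newton (noisyKernel fZ k) αt g₀ (fun i => Y i ω) n θ
        * Real.log (newton k α g₀ (fun i => X i ω) n θ)) P := by
    intro n
    choose c hc hle using exists_le_newton H.pos_k hg₀ hα.mem_Ioo n
    refine Integrable.of_bound ((hm n).mono (M.past_le n) le_rfl).aestronglyMeasurable
      (∑ θ, -Real.log (c θ)) (Eventually.of_forall fun ω => ?_)
    rw [Real.norm_of_nonneg (h0 n ω), ← Finset.sum_neg_distrib]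
    refine Finset.sum_le_sum fun θ _ => ?_
    rw [← mul_neg]
    refine (mul_le_of_le_one_left ?_ (openSimplex.le_one (hmem n ω) θ)).trans
      (neg_le_neg (Real.log_le_log (hc θ) (hle θ _)))
    exact neg_nonneg.2 (Real.log_nonpos ((hmem' n ω).1 θ).le (openSimplex.le_one (hmem' n ω) θ))
  have hD0 : ∀ n ω, 0 ≤ α (n + 1) * (mixtureSqNorm k
      (newton (noisyKernel fZ k) αt g₀ (fun i => Y i ω) n
        - newton k α g₀ (fun i => X i ω) n) / C) := fun n ω =>
    mul_nonneg (hα0 n).le (div_nonneg (mixtureSqNorm_nonneg k _) hC.le)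
  have hDm : ∀ n, Measurable[M.pastFiltration n] fun ω => α (n + 1) * (mixtureSqNorm k
      (newton (noisyKernel fZ k) αt g₀ (fun i => Y i ω) n
        - newton k α g₀ (fun i => X i ω) n) / C) := fun n =>
    (((continuous_mixtureSqNorm H.measurable_k H.pos_k H.isDensity_k ⟨C, H.le_k⟩).measurable.comp
      ((M.measurable_noisy H n).sub (M.measurable_oracle H α n))).div_const C).const_mul _
  obtain ⟨B, hB⟩ := exists_mixtureSqNorm_sub_le H
  have hDi : ∀ n, Integrable (fun ω => α (n + 1) * (mixtureSqNorm k
      (newton (noisyKernel fZ k) αt g₀ (fun i => Y i ω) n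
        - newton k α g₀ (fun i => X i ω) n) / C)) P := by
    intro n
    refine Integrable.of_bound ((hDm n).mono (M.past_le n) le_rfl).aestronglyMeasurable
      (α (n + 1) * (B / C)) (Eventually.of_forall fun ω => ?_)
    rw [Real.norm_of_nonneg (hD0 n ω)]
    exact mul_le_mul_of_nonneg_left (div_le_div_of_nonneg_right (hB _ (hmem' n ω) _ (hmem n ω))
      hC.le) (hα0 n).le
  have hpos : ∀ n, 0 < 1 - α (n + 1) := fun n => by
    linarith [(hα.mem_Ioo (n + 1) (by omega)).2]
  have hR := ratioBound_nonneg H.pos_k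
  refine almostSupermartingale_tendsto (P := P) (ℱ := M.pastFiltration)
    (c := fun n => Fintype.card Θ * (αt (n + 1) ^ 2 + (α (n + 1) ^ 2
      + α (n + 1) ^ 2 / (1 - α (n + 1))) * (ratioBound k + 1)))
    hm hDm hi hDi h0 hD0 (fun n => ?_)
    ((hαt.summable_sq.add ((hα.summable_sq.add hα.summable_sq_div).mul_right _)).mul_left _) ?_
  · have := hpos n
    positivity
  intro n A hA
  have hnext : ∀ ω, newton (noisyKernel fZ k) αt g₀ (fun i => Y i ω) (n + 1)
      = newtonStep (noisyKernel fZ k) (αt (n + 1))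
        (newton (noisyKernel fZ k) αt g₀ (fun i => Y i ω) n) (X (n + 1) ω + Z (n + 1) ω) :=
    fun ω => by rw [newton_succ, M.Y_eq (n + 1) (by omega)]
  have hnext' : ∀ ω, newton k α g₀ (fun i => X i ω) (n + 1)
      = newtonStep k (α (n + 1)) (newton k α g₀ (fun i => X i ω) n) (X (n + 1) ω) :=
    fun ω => newton_succ _ _ _ _ _
  have hi1 := hi (n + 1)
  simp only [hnext, hnext'] at hi1 ⊢
  refine M.setIntegral_step_le H n hA
    (S := fun ω => (newton k α g₀ (fun i => X i ω) n,
      newton (noisyKernel fZ k) αt g₀ (fun i => Y i ω) n))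
    (Measurable.prodMk (M.measurable_oracle H α n) (M.measurable_noisy H n))
    (fun ω => rfl) (hmem n)
    (Φ := fun q => -∑ θ, newtonStep (noisyKernel fZ k) (αt (n + 1)) q.1.2 (q.2.1 + q.2.2) θ
      * Real.log (newtonStep k (α (n + 1)) q.1.1 q.2.1 θ)) ?_ hi1
    (((hi n).sub (hDi n)).add (integrable_const _)) fun ω => ?_
  · exact measurable_crossEntropy
      ((measurable_newtonStep H.measurable_noisy _).comp
        ((measurable_snd.comp measurable_fst).prodMk
          ((measurable_fst.comp measurable_snd).add (measurable_snd.comp measurable_snd))))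
      ((measurable_newtonStep H.measurable_k _).comp
        ((measurable_fst.comp measurable_fst).prodMk (measurable_fst.comp measurable_snd)))
  · exact H.integral_crossEntropy_step_le (hmem' n ω) (hmem n ω)
      (hα.mem_Ioo (n + 1) (by omega)) (hαt.mem_Ioo (n + 1) (by omega))

/-- Both estimates converge almost surely, to the same limit. -/
lemma ae_exists_tendsto (M : IsDeconvolutionModel P k fZ αt g₀ X Y Z)
    (H : DeconvolutionAssumptions k fZ C) (hC : 0 < C) (hg₀ : g₀ ∈ openSimplex Θ)
    (hident : ∀ g ∈ stdSimplex ℝ Θ, ∀ g' ∈ stdSimplex ℝ Θ, mixture k g = mixture k g' → g = g')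
    (hα : IsLearningRate α) (hαt : IsLearningRate αt) :
    ∀ᵐ ω ∂P, ∃ h,
      Tendsto (fun n => newton (noisyKernel fZ k) αt g₀ (fun i => Y i ω) n) atTop (𝓝 h) ∧
      Tendsto (fun n => newton k α g₀ (fun i => X i ω) n) atTop (𝓝 h) := by
  filter_upwards [ae_all_iff.2 fun θ => M.ae_tendsto_neg_log_noisy H hg₀ hαt θ,
    M.ae_tendsto_crossEntropy H hC hg₀ hα hαt] with ω h1 ⟨⟨w, hw⟩, hsum⟩
  choose l hl using h1
  have hmem : ∀ n, newton (noisyKernel fZ k) αt g₀ (fun i => Y i ω) n ∈ openSimplex Θ :=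
    fun n => newton_mem H.pos_noisy hg₀ hαt.mem_Ioo _ n
  have hmem' : ∀ n, newton k α g₀ (fun i => X i ω) n ∈ openSimplex Θ :=
    fun n => newton_mem H.pos_k hg₀ hα.mem_Ioo _ n
  -- Convergence of `-log` to a finite limit places every coordinate of the limit in `(0, ∞)`, as
  -- the cross entropy argument requires.
  have hlim : Tendsto (fun n => newton (noisyKernel fZ k) αt g₀ (fun i => Y i ω) n) atTop
      (𝓝 fun θ => Real.exp (-l θ)) := by
    refine tendsto_pi_nhds.2 fun θ => ?_
    refine ((Real.continuous_exp.tendsto _).comp (hl θ).neg).congr fun n => ?_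
    simp [Real.exp_log ((hmem n).1 θ)]
  refine ⟨_, hlim, tendsto_of_crossEntropy_tendsto (a := fun n => α (n + 1))
    (Q := fun v => mixtureSqNorm k v / C) hmem hmem' hlim
    (fun θ => Real.exp_pos _) hw (fun n => (hα.mem_Ioo (n + 1) (by omega)).1) hα.not_summable hsum
    ((continuous_mixtureSqNorm H.measurable_k H.pos_k H.isDensity_k ⟨C, H.le_k⟩).div_const C)
    fun g hg g' hg' hQ => hident g hg g' hg' ?_⟩
  exact mixture_eq_of_mixtureSqNorm_sub_nonpos H.continuous_k H.pos_k H.isDensity_k ⟨C, H.le_k⟩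
    (by simpa using (div_le_iff₀ hC).1 hQ)

end IsDeconvolutionModel

/-! ### The main theorem and a measurable version of the limit. -/

theorem theorem2 {Ω Θ : Type*} [MeasurableSpace Ω] [Fintype Θ]
    (P : Measure Ω) [IsProbabilityMeasure P]
    (k : Θ → ℝ → ℝ) (fZ : ℝ → ℝ) (g₀ : Θ → ℝ) (α αt : ℕ → ℝ) (X Y Z : ℕ → Ω → ℝ)
    -- the initial guess, common to both recursions, is a strictly positive probability function
    (hg₀ : g₀ ∈ stdSimplex ℝ Θ) (hg₀_pos : ∀ θ, 0 < g₀ θ)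
    -- the kernel
    (hk_dens : ∀ θ, IsDensity (k θ))
    (hk_pos : ∀ θ x, 0 < k θ x)
    (hk_bdd : ∃ C : ℝ, ∀ θ x, k θ x ≤ C)
    (hk_diff : ∀ θ, ContDiff ℝ 1 (k θ))
    (hk_deriv : ∃ C : ℝ, ∀ θ x, |deriv (k θ) x| ≤ C)
    -- mixtures of the kernel identify the mixing probability function
    (hk_ident : ∀ g ∈ stdSimplex ℝ Θ, ∀ g' ∈ stdSimplex ℝ Θ, mixture k g = mixture k g' → g = g')
    -- the noise density
    (hfZ_dens : IsDensity fZ)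
    (hfZ_pos : ∀ z, 0 < fZ z)
    (hfZ_bdd : ∃ C : ℝ, ∀ z, fZ z ≤ C)
    (hfZ_cont : UniformContinuous fZ)
    -- the additional integrability condition on the kernel
    (hk_int : ∀ θ₁ θ₂ θ₃, Integrable (fun x => k θ₁ x ^ 2 / k θ₂ x ^ 2 * k θ₃ x))
    -- the learning rates of the oracle recursion and of Newton's algorithm on the noisy data
    (hα : IsLearningRate α) (hαt : IsLearningRate αt)
    (hmodel : IsDeconvolutionModel P k fZ αt g₀ X Y Z) :
    (∀ᵐ ω ∂P, Tendsto (fun n => ⨆ θ, |newton k α g₀ (fun i => X i ω) n θ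
        - newton (noisyKernel fZ k) αt g₀ (fun i => Y i ω) n θ|) atTop (𝓝 0)) ∧
    ∃ gt : Ω → Θ → ℝ, Measurable gt ∧ (∀ ω, gt ω ∈ stdSimplex ℝ Θ) ∧
      (∀ᵐ ω ∂P, Tendsto (fun n => ⨆ θ,
        |newton (noisyKernel fZ k) αt g₀ (fun i => Y i ω) n θ - gt ω θ|) atTop (𝓝 0)) ∧
      (∀ᵐ ω ∂P, Tendsto (fun n => ⨆ θ,
        |newton k α g₀ (fun i => X i ω) n θ - gt ω θ|) atTop (𝓝 0)) := by
  have hmem : g₀ ∈ openSimplex Θ := ⟨hg₀_pos, hg₀.2⟩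
  obtain ⟨C, hC⟩ := hk_bdd
  obtain ⟨θ₀⟩ := openSimplex.nonempty hmem
  have hC0 : 0 < C := (hk_pos θ₀ 0).trans_le (hC θ₀ 0)
  have H : DeconvolutionAssumptions k fZ C :=
    ⟨fun θ => (hk_diff θ).continuous, hk_pos, hk_dens, hC, hk_int, hfZ_cont.continuous.measurable,
      hfZ_dens, hfZ_pos, hfZ_bdd⟩
  have hlim := hmodel.ae_exists_tendsto H hC0 hmem hk_ident hα hαt
  refine ⟨?_, ?_⟩
  · filter_upwards [hlim] with ω ⟨h, h1, h2⟩ using tendsto_iSup_abs_sub h2 h1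
  obtain ⟨f, hf, hft⟩ := measurable_limit_of_tendsto_metrizable_ae (μ := P) (L := atTop)
    (f := fun n ω => newton (noisyKernel fZ k) αt g₀ (fun i => Y i ω) n)
    (fun n => ((hmodel.measurable_noisy H n).mono (hmodel.past_le n) le_rfl).aemeasurable)
    (hlim.mono fun ω ⟨h, h1, _⟩ => ⟨h, h1⟩)
  have hE : MeasurableSet {ω | f ω ∈ stdSimplex ℝ Θ} :=
    hf (isClosed_stdSimplex ℝ Θ).measurableSet
  classical
  -- The measurable limit `f` is controlled only almost surely; the default `g₀` keeps `gt` in the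
  -- simplex for every `ω`.
  let gt : Ω → Θ → ℝ := fun ω => if f ω ∈ stdSimplex ℝ Θ then f ω else g₀
  have hgt : ∀ᵐ ω ∂P,
      Tendsto (fun n => newton (noisyKernel fZ k) αt g₀ (fun i => Y i ω) n) atTop (𝓝 (gt ω)) ∧
      Tendsto (fun n => newton k α g₀ (fun i => X i ω) n) atTop (𝓝 (gt ω)) := by
    filter_upwards [hlim, hft] with ω ⟨h, h1, h2⟩ h3
    have hs : f ω ∈ stdSimplex ℝ Θ := (isClosed_stdSimplex ℝ Θ).mem_of_tendsto h3
      (Eventually.of_forall fun n =>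
        openSimplex.mem_stdSimplex (newton_mem H.pos_noisy hmem hαt.mem_Ioo _ n))
    have e : gt ω = f ω := if_pos hs
    rw [e]
    exact ⟨h3, tendsto_nhds_unique h1 h3 ▸ h2⟩
  refine ⟨gt, Measurable.ite hE hf measurable_const, fun ω => ?_, ?_, ?_⟩
  · by_cases h : f ω ∈ stdSimplex ℝ Θ
    · simpa only [gt, if_pos h] using h
    · simpa only [gt, if_neg h] using hg₀
  · filter_upwards [hgt] with ω h using tendsto_iSup_abs_sub h.1 tendsto_const_nhds
  · filter_upwards [hgt] with ω h using tendsto_iSup_abs_sub h.2 tendsto_const_nhds
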